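/- Let $n>2k\ge 6$ be integers. For a family $\mathcal F\subset\binom{[n]}{k}$ let $\Delta(\mathcal F)$ be its maximal degree, i.e. the largest number of members of $\mathcal F$ containing a common element of $[n]$, and let $\gamma(\mathcal F)=|\mathcal F|-\Delta(\mathcal F)$ be its diversity. For integers $a\le b$ write $[a,b]=\{a,a+1,\dots,b\}$. The $(n-k-1)$-cascade form of a positive integer $\gamma$ is written as $$\gamma=\binom{n-b_1}{n-k-1}+\binom{n-b_2}{n-k-2}+\dots+\binom{n-b_s}{n-k-s},\qquad 1\le b_1<b_2<\dots<b_s,$$ where $s\ge 1$, $n-k-s\ge 1$ and $n-b_i\ge n-k-i$ for all $i$. If it exists, put $T_\gamma=\{b_1,\dots,b_s\}$ and $S_\gamma=\{b_s\}\cup([2,b_s]\setminus T_\gamma)$. Call $\gamma$ resistant if either $\gamma=\binom{n-4}{k-3}$, or $\gamma$ has such a form with $|S_\gamma|\le k$, $|T_\gamma|\le k-1$ and $b_i>2i+2$ for all $1\le i\le s$. Then there are only finitely many resistant numbers $\gamma_1<\gamma_2<\dots<\gamma_m$; moreover $m\ge1$, $\gamma_1=1$, $\gamma_m=\binom{n-4}{k-3}$,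 and each $\gamma_l$ has exactly one cascade form as above. Put $\gamma_0=0$, and for $1\le l\le m$ write $S_{\gamma_l}=\{a_1<a_2<\dots<a_t\}$ (where $t$ and the $a_i$ depend on $l$) and $$B_l=\binom{n-a_1}{n-k}+\binom{n-a_2}{n-k-1}+\dots+\binom{n-a_t}{n-k+1-t}+\gamma_l .$$ The following hold. 1. For every $1\le l\le m$, every intersecting family $\mathcal F\subset\binom{[n]}{k}$ with $\gamma_{l-1}<\gamma(\mathcal F)\le\gamma_l$ satisfies $|\mathcal F|\le B_l$. 2. $B_l$ strictly decreases as $l$ increases: $B_1>B_2>\dots>B_m$. 3. The bound is sharp: for every $1\le l\le m$ there is an intersecting family $\mathcal F\subset\binom{[n]}{k}$ with $\gamma(\mathcal F)=\gamma_l$ and $|\mathcal F|=B_l$. -/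

import Mathlib

/-- The 1-based position of `x` in the increasing enumeration of a finite set of naturals:
if `X = {x₁ < x₂ < ⋯ < x_s}` then `pos X xᵢ = i`. -/
def pos (X : Finset ℕ) (x : ℕ) : ℕ :=
  (X.filter (fun y => y ≤ x)).card

/-- The set `T = {b₁ < ⋯ < b_s}` of positive integers encodes the `(n-k-1)`-cascade form of `γ`,
`γ = C(n-b₁, n-k-1) + C(n-b₂, n-k-2) + ⋯ + C(n-b_s, n-k-s)`. -/
structure IsCascadeForm (n k γ : ℕ) (T : Finset ℕ) : Prop where
  /-- there is at least one term -/
  nonempty : T.Nonempty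
  /-- `1 ≤ b₁` -/
  one_le : ∀ b ∈ T, 1 ≤ b
  /-- the lower indices `n-k-1, …, n-k-s` are all at least `1` -/
  card_lt : T.card < n - k
  /-- each upper index is at least the corresponding lower index, `n - bᵢ ≥ n - k - i` -/
  lower_le_upper : ∀ b ∈ T, n - k - pos T b ≤ n - b
  /-- the value of the cascade -/
  sum_eq : γ = ∑ b ∈ T, (n - b).choose (n - k - pos T b)

/-- For `T = {b₁ < ⋯ < b_s}` nonempty, the set `{b_s} ∪ ([2, b_s] \ T)`
(the supremum of a nonempty finite set of naturals is its largest element `b_s`). -/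
def complSet (T : Finset ℕ) : Finset ℕ :=
  insert (T.sup id) (Finset.Icc 2 (T.sup id) \ T)

/-- Resistant numbers. -/
def IsResistant (n k γ : ℕ) : Prop :=
  (∃ T : Finset ℕ, IsCascadeForm n k γ T ∧
      (complSet T).card ≤ k ∧ T.card ≤ k - 1 ∧ ∀ b ∈ T, 2 * pos T b + 2 < b) ∨
    γ = (n - 4).choose (k - 3)

/-- The number `m` of resistant numbers. -/
noncomputable def resistantCount (n k : ℕ) : ℕ :=
  {γ : ℕ | IsResistant n k γ}.ncard

/-- `γ_0 = 0`, and `γ_1 < γ_2 < ⋯ < γ_m` are the resistant numbers in increasing order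
(`Nat.nth p` enumerates increasingly, from index `0`, the naturals satisfying `p`). -/
noncomputable def resistantNumber (n k : ℕ) : ℕ → ℕ
  | 0 => 0
  | l + 1 => Nat.nth (IsResistant n k) l

/-- For `S = {a₁ < ⋯ < a_t}`, the sum
`C(n-a₁, n-k) + C(n-a₂, n-k-1) + ⋯ + C(n-a_t, n-k+1-t)`. -/
def dualSum (n k : ℕ) (S : Finset ℕ) : ℕ :=
  ∑ a ∈ S, (n - a).choose (n - k + 1 - pos S a)

/-- The right-hand side of the bound for a number `γ` whose `(n-k-1)`-cascade form is given
by `T`. -/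
def diversityBound (n k γ : ℕ) (T : Finset ℕ) : ℕ :=
  dualSum n k (complSet T) + γ

/-- The maximal degree of an element of the ground set. -/
def maxDegree {n : ℕ} (F : Finset (Finset (Fin n))) : ℕ :=
  Finset.univ.sup (fun i : Fin n => (F.filter (fun A => i ∈ A)).card)

/-- The diversity: the size minus the maximal degree. -/
def diversity {n : ℕ} (F : Finset (Finset (Fin n))) : ℕ :=
  F.card - maxDegree F

/-- `F` is an intersecting family of `k`-element subsets of an `n`-element set. -/
def IsIntersectingFamily (n k : ℕ) (F : Finset (Finset (Fin n))) : Prop :=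
  F ⊆ Finset.powersetCard k Finset.univ ∧ ∀ A ∈ F, ∀ B ∈ F, (A ∩ B).Nonempty

/-!
Delete a point of maximal degree, called `1`, from the ground set and reflect the rest onto
`{0, …, n - 2}` by `b ↦ n - b`. An intersecting family of `k`-sets becomes a family `𝒜` of sets of
size `q = k - 1`, from the members through `1`, and a family `ℬ` of sets of size `r = n - k - 1`, the
complements of the other members, such that no member of `𝒜` lies in a member of `ℬ`. The diversity
is `|ℬ|`. By the Kruskal–Katona theorem `𝒜` is largest when `ℬ` is an initial segment of the colex
order. Such a segment consists of the `r`-sets that precede some set `T` of at most `r` elements,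
called a *cut* here, and `T` is the set of upper indices of the cascade of `|ℬ|`. The `q`-sets that
precede `T` all lie in the iterated shadow of the segment (`exists_superset_mem_lowerFamily`), so
that `|𝒜|` is at most the number `upper (n - 1) q T` of `q`-sets that do not precede `T`
(`card_le_upper`), and this number is the dual sum of the theorem (`dualSum_complSet`).

It remains to study how `upper (n - 1) q T + lower (n - 1) r T` changes when the cut `T` is raised.
The sets passed by the cut fall into blocks: sets that agree with a given pattern from some `t`
upwards and are arbitrary below `t`. A block whose pattern has `i` elements contains `C(t, q - i)`
sets of size `q` and `C(t, r - i)` sets of size `r`. As `q < r`, there are more of the former,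
equally many, or fewer of them (unless there are none of either size) according as `t` is less
than, equal to or greater than `q + r - 2 * i`. The condition `bᵢ > 2 * i + 2` (here `Slack 3`) describes the cuts that stay in the region where the
sets of size `q` prevail. Therefore the sum strictly decreases along the resistant cuts
(`lower_add_lower_lt`). Where the condition fails for the first time, equality `t = q + r - 2 * i`
holds, and raising the cut to the end of that block does not decrease the sum. The result of this
may be a cut that again just fails the condition, but higher up; after finitely many steps a
resistant cut is reached (`exists_slack`). All these comparisons are inductions on the top element
of the ground set.

Conversely, each resistant cut gives an intersecting family that attains the bound
(`IsResistantCut.exists_isIntersectingFamily`).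
-/

namespace ColexCount

open Finset
open scoped FinsetFamily

/-! ### Comparison of binomial coefficients -/

theorem choose_lt_choose_of_lt_of_two_mul_le {t x y : ℕ} (hxy : x < y) (h : 2 * y ≤ t) :
    t.choose x < t.choose y := by
  induction y with
  | zero => omega
  | succ y ih =>
    have h1 : t.choose y < t.choose (y + 1) := by
      have e := Nat.choose_succ_right_eq t y
      have hp : 0 < t.choose y := Nat.choose_pos (by omega)
      by_contra! hle
      have h2 : t.choose (y + 1) * (y + 1) ≤ t.choose y * (y + 1) := Nat.mul_le_mul_right _ hle
      have h3 : t.choose y * (y + 1) < t.choose y * (t - y) :=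
        Nat.mul_lt_mul_of_pos_left (by omega) hp
      omega
    rcases Nat.lt_succ_iff_lt_or_eq.1 hxy with h2 | rfl
    · exact (ih h2 (by omega)).trans h1
    · exact h1

theorem choose_lt_choose_of_add_lt {t x y : ℕ} (hxy : x < y) (h : x + y < t) :
    t.choose x < t.choose y := by
  by_cases h2 : 2 * y ≤ t
  · exact choose_lt_choose_of_lt_of_two_mul_le hxy h2
  · rw [← Nat.choose_symm (n := t) (k := y) (by omega)]
    exact choose_lt_choose_of_lt_of_two_mul_le (by omega) (by omega)

theorem choose_lt_choose_of_lt_add {t x y : ℕ} (hxy : x < y) (hx : x ≤ t) (h : t < x + y) :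
    t.choose y < t.choose x := by
  by_cases hy : y ≤ t
  · rw [← Nat.choose_symm hx, ← Nat.choose_symm hy]
    exact choose_lt_choose_of_add_lt (by omega) (by omega)
  · rw [Nat.choose_eq_zero_of_lt (by omega)]
    exact Nat.choose_pos hx

theorem choose_eq_choose_of_add_eq {t x y : ℕ} (h : x + y = t) : t.choose x = t.choose y :=
  Nat.choose_symm_of_eq_add h.symm

theorem choose_le_choose_of_add_le {t x y : ℕ} (hxy : x ≤ y) (h : x + y ≤ t) :
    t.choose x ≤ t.choose y := by
  rcases hxy.eq_or_lt with rfl | hxy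
  · exact le_rfl
  rcases h.eq_or_lt with h | h
  · exact (choose_eq_choose_of_add_eq h).le
  · exact (choose_lt_choose_of_add_lt hxy h).le

theorem choose_le_choose_of_le_add {t x y : ℕ} (hxy : x ≤ y) (h : t ≤ x + y) :
    t.choose y ≤ t.choose x := by
  rcases hxy.eq_or_lt with rfl | hxy
  · exact le_rfl
  rcases h.eq_or_lt with h | h
  · exact (choose_eq_choose_of_add_eq h.symm).ge
  by_cases hx : x ≤ t
  · exact (choose_lt_choose_of_lt_add hxy hx h).le
  · rw [Nat.choose_eq_zero_of_lt (show t < y by omega)]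
    exact Nat.zero_le _

/-! ### Counting the sets on either side of a cut in the colex order -/

/-- The `p`-element subsets of `{0, …, m - 1}` that precede `T` in the colex order. The set `T` is a
cut of the order and may have any size. -/
def lowerFamily (m p : ℕ) (T : Finset ℕ) : Finset (Finset ℕ) :=
  (powersetCard p (range m)).filter (fun X => toColex X < toColex T)

/-- The `p`-element subsets of `{0, …, m - 1}` that do not precede `T` in the colex order. -/
def upperFamily (m p : ℕ) (T : Finset ℕ) : Finset (Finset ℕ) :=
  (powersetCard p (range m)).filter (fun X => ¬ toColex X < toColex T)

/-- The number of `p`-element subsets of `{0, …, m - 1}` that precede `T` in the colex order. -/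
def lower (m p : ℕ) (T : Finset ℕ) : ℕ := (lowerFamily m p T).card

/-- The number of `p`-element subsets of `{0, …, m - 1}` that do not precede `T` in the colex
order. -/
def upper (m p : ℕ) (T : Finset ℕ) : ℕ := (upperFamily m p T).card

theorem lower_add_upper (m p : ℕ) (T : Finset ℕ) : lower m p T + upper m p T = m.choose p := by
  rw [lower, upper, lowerFamily, upperFamily, card_filter_add_card_filter_not, card_powersetCard,
    card_range]

theorem lower_empty (m p : ℕ) : lower m p ∅ = 0 := by
  simp [lower, lowerFamily]

theorem upper_empty (m p : ℕ) : upper m p ∅ = m.choose p := by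
  simpa [lower_empty] using lower_add_upper m p ∅

theorem lower_succ_of_subset {m : ℕ} (p : ℕ) {T : Finset ℕ} (hT : T ⊆ range m) :
    lower (m + 1) p T = lower m p T := by
  unfold lower lowerFamily
  congr 1
  ext X
  simp only [mem_filter, mem_powersetCard]
  refine ⟨fun ⟨⟨_, h2⟩, h3⟩ => ⟨⟨fun x hx => ?_, h2⟩, h3⟩,
    fun ⟨⟨h1, h2⟩, h3⟩ => ⟨⟨h1.trans (range_mono (Nat.le_succ m)), h2⟩, h3⟩⟩
  exact mem_range.2 (Colex.forall_lt_mono h3.le (fun b hb => mem_range.1 (hT hb)) x hx)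

theorem lower_of_subset_of_le {m m' : ℕ} (p : ℕ) {T : Finset ℕ} (hT : T ⊆ range m) (h : m ≤ m') :
    lower m' p T = lower m p T := by
  induction m', h using Nat.le_induction with
  | base => rfl
  | succ j hj ih => rw [lower_succ_of_subset p (hT.trans (range_mono hj)), ih]

theorem toColex_lt_toColex_insert {m : ℕ} {X T : Finset ℕ} (hX : X ⊆ range m) :
    toColex X < toColex (insert m T) := by
  rw [Colex.toColex_lt_toColex_iff_exists_forall_lt]
  exact ⟨m, mem_insert_self _ _, fun h => by simpa using hX h, fun b hb _ => mem_range.1 (hX hb)⟩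

theorem toColex_insert_lt_toColex_insert {m : ℕ} {X T : Finset ℕ} (hX : X ⊆ range m)
    (hT : T ⊆ range m) :
    toColex (insert m X) < toColex (insert m T) ↔ toColex X < toColex T := by
  have h1 : m ∉ X := fun h => by simpa using hX h
  have h2 : m ∉ T := fun h => by simpa using hT h
  rw [← Colex.toColex_sdiff_lt_toColex_sdiff (u := {m}) (by simp) (by simp)]
  simp [sdiff_singleton_eq_erase, erase_eq_of_notMem, h1, h2]

theorem lower_succ_insert {m : ℕ} (p : ℕ) {T : Finset ℕ} (hT : T ⊆ range m) :
    lower (m + 1) (p + 1) (insert m T) = m.choose (p + 1) + lower m p T := by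
  have hm : m ∉ range m := by simp
  unfold lower lowerFamily
  rw [range_add_one, powersetCard_succ_insert hm, filter_union, card_union_of_disjoint]
  · congr 1
    · rw [filter_true_of_mem, card_powersetCard, card_range]
      exact fun X hX => toColex_lt_toColex_insert (mem_powersetCard.1 hX).1
    · rw [filter_image, card_image_of_injOn]
      · congr 1
        exact filter_congr fun X hX =>
          toColex_insert_lt_toColex_insert (mem_powersetCard.1 hX).1 hT
      · intro X hX Y hY hXY
        have hX' : m ∉ X := fun h => hm ((mem_powersetCard.1 (mem_filter.1 hX).1).1 h)
        have hY' : m ∉ Y := fun h => hm ((mem_powersetCard.1 (mem_filter.1 hY).1).1 h)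
        rw [← erase_insert hX', ← erase_insert hY']
        exact congrArg (fun Z => erase Z m) hXY
  · rw [disjoint_left]
    intro X h1 h2
    obtain ⟨Y, -, rfl⟩ := mem_image.1 (mem_filter.1 h2).1
    exact hm ((mem_powersetCard.1 (mem_filter.1 h1).1).1 (mem_insert_self _ _))

theorem lower_zero_insert (m : ℕ) (T : Finset ℕ) : lower (m + 1) 0 (insert m T) = 1 := by
  have : (∅ : Finset ℕ) ⊆ range m := by simp
  have h := toColex_lt_toColex_insert (T := T) this
  unfold lower lowerFamily
  rw [powersetCard_zero, filter_true_of_mem]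
  · simp
  · intro X hX
    rw [mem_singleton.1 hX]
    exact h

theorem upper_zero_insert (m : ℕ) (T : Finset ℕ) : upper (m + 1) 0 (insert m T) = 0 := by
  have := lower_add_upper (m + 1) 0 (insert m T)
  rw [lower_zero_insert, Nat.choose_zero_right] at this
  omega

theorem upper_succ_insert {m : ℕ} (p : ℕ) {T : Finset ℕ} (hT : T ⊆ range m) :
    upper (m + 1) (p + 1) (insert m T) = upper m p T := by
  have h1 := lower_add_upper (m + 1) (p + 1) (insert m T)
  have h2 := lower_add_upper m p T
  rw [lower_succ_insert p hT, Nat.choose_succ_succ'] at h1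
  omega

theorem upper_succ_of_subset {m : ℕ} (p : ℕ) {T : Finset ℕ} (hT : T ⊆ range m) :
    upper (m + 1) (p + 1) T = m.choose p + upper m (p + 1) T := by
  have h1 := lower_add_upper (m + 1) (p + 1) T
  have h2 := lower_add_upper m (p + 1) T
  rw [lower_succ_of_subset _ hT, Nat.choose_succ_succ'] at h1
  omega

theorem upper_zero_of_subset {m : ℕ} {T : Finset ℕ} (hT : T ⊆ range m) :
    upper (m + 1) 0 T = upper m 0 T := by
  have h1 := lower_add_upper (m + 1) 0 T
  have h2 := lower_add_upper m 0 T
  rw [lower_succ_of_subset _ hT] at h1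
  simp only [Nat.choose_zero_right] at h1 h2
  omega

/-- Cuts of `{0, …, m}` are treated by recursion on the top element. -/
theorem subset_range_succ_cases {m : ℕ} {T : Finset ℕ} (hT : T ⊆ range (m + 1)) :
    T ⊆ range m ∨ ∃ T₀, T = insert m T₀ ∧ T₀ ⊆ range m := by
  rw [range_add_one] at hT
  by_cases h : m ∈ T
  · exact .inr ⟨T.erase m, (insert_erase h).symm, by rwa [← subset_insert_iff]⟩
  · exact .inl ((subset_insert_iff_of_notMem h).1 hT)

theorem card_insert_top {m : ℕ} {T : Finset ℕ} (hT : T ⊆ range m) :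
    (insert m T).card = T.card + 1 :=
  card_insert_of_notMem fun h => by simpa using hT h

theorem insert_top_subset {m : ℕ} {T : Finset ℕ} (hT : T ⊆ range m) :
    insert m T ⊆ range (m + 1) := by
  rw [range_add_one]
  exact insert_subset_insert _ hT

/-- The number of elements of `T` above `t`. -/
def above (T : Finset ℕ) (t : ℕ) : ℕ := (T.filter (fun u => t < u)).card

theorem above_insert_top {m t : ℕ} {T : Finset ℕ} (hT : T ⊆ range m) (ht : t < m) :
    above (insert m T) t = above T t + 1 := by
  unfold above
  rw [filter_insert, if_pos ht, card_insert_of_notMem]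
  exact fun h => by simpa using hT (mem_filter.1 h).1

theorem above_eq_zero {m : ℕ} {T : Finset ℕ} (hT : T ⊆ range m) {t : ℕ} (ht : m ≤ t + 1) :
    above T t = 0 := by
  unfold above
  rw [card_eq_zero, filter_eq_empty_iff]
  intro u hu
  have := mem_range.1 (hT hu)
  omega

theorem above_insert_top_self {m : ℕ} {T : Finset ℕ} (hT : T ⊆ range m) :
    above (insert m T) m = 0 :=
  above_eq_zero (insert_top_subset hT) le_rfl

/-- `T = {t₁ > t₂ > ⋯}` consists of the upper indices of a cascade
`C(t₁, p) + C(t₂, p - 1) + ⋯`: there are at most `p` of them, and no upper index is smaller than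
the lower index it goes with. -/
def Valid (p : ℕ) (T : Finset ℕ) : Prop :=
  T.card ≤ p ∧ ∀ t ∈ T, p ≤ t + above T t

theorem valid_empty (p : ℕ) : Valid p ∅ := by simp [Valid]

theorem valid_insert_top {m p : ℕ} {T : Finset ℕ} (hT : T ⊆ range m) :
    Valid (p + 1) (insert m T) ↔ p + 1 ≤ m ∧ Valid p T := by
  unfold Valid
  rw [card_insert_top hT, forall_mem_insert, above_insert_top_self hT]
  constructor
  · rintro ⟨h1, h2, h3⟩
    refine ⟨h2, by omega, fun t ht => ?_⟩
    have := h3 t ht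
    rw [above_insert_top hT (mem_range.1 (hT ht))] at this
    omega
  · rintro ⟨h1, h2, h3⟩
    refine ⟨by omega, h1, fun t ht => ?_⟩
    have := h3 t ht
    rw [above_insert_top hT (mem_range.1 (hT ht))]
    omega

theorem Valid.pos_of_insert_top {m p : ℕ} {T : Finset ℕ} (hT : T ⊆ range m)
    (h : Valid p (insert m T)) : 0 < p := by
  have := h.1
  rw [card_insert_top hT] at this
  omega

/-- For every element `t` of `T`, with `i` elements of `T` above it, `t + 2 * i + d ≤ c`. -/
def Slack (d c : ℕ) (T : Finset ℕ) : Prop := ∀ t ∈ T, t + 2 * above T t + d ≤ c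

theorem slack_empty (d c : ℕ) : Slack d c ∅ := by simp [Slack]

theorem slack_insert_top {m d c : ℕ} {T : Finset ℕ} (hT : T ⊆ range m) :
    Slack d (c + 2) (insert m T) ↔ m + d ≤ c + 2 ∧ Slack d c T := by
  unfold Slack
  rw [forall_mem_insert, above_insert_top_self hT]
  refine and_congr (by omega) (forall₂_congr fun t ht => ?_)
  rw [above_insert_top hT (mem_range.1 (hT ht))]
  omega

theorem Slack.mono {d d' c : ℕ} {T : Finset ℕ} (h : Slack d c T) (hd : d' ≤ d) : Slack d' c T :=
  fun t ht => by have := h t ht; omega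

/-! ### Cascades -/

theorem Valid.le_of_nonempty {m p : ℕ} {T : Finset ℕ} (h : Valid p T) (hT : T ⊆ range m)
    (hne : T.Nonempty) : p < m := by
  have h1 := h.2 _ (T.max'_mem hne)
  have h2 : above T (T.max' hne) = 0 :=
    above_eq_zero (m := T.max' hne + 1)
      (fun t ht => mem_range.2 (Nat.lt_succ_of_le (T.le_max' t ht))) le_rfl
  have h3 := mem_range.1 (hT (T.max'_mem hne))
  omega

theorem upper_pos {m : ℕ} : ∀ {p : ℕ} {T : Finset ℕ}, T ⊆ range m → Valid p T → p ≤ m →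
    0 < upper m p T := by
  induction m with
  | zero =>
    intro p T hT h hp
    have hT0 : T = ∅ := subset_empty.1 hT
    have hp0 : p = 0 := by omega
    subst hT0 hp0
    simp [upper_empty]
  | succ m ih =>
    intro p T hTm h hp
    rcases T.eq_empty_or_nonempty with rfl | hne
    · rw [upper_empty]
      exact Nat.choose_pos hp
    rcases subset_range_succ_cases hTm with hT | ⟨T, rfl, hT⟩
    · have h1 := ih hT h (h.le_of_nonempty hT hne).le
      cases p with
      | zero => rwa [upper_zero_of_subset hT]
      | succ p => rw [upper_succ_of_subset p hT]; omega
    · obtain ⟨p, rfl⟩ := Nat.exists_eq_add_one_of_ne_zero (h.pos_of_insert_top hT).ne'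
      rw [upper_succ_insert p hT]
      exact ih hT ((valid_insert_top hT).1 h).2 (by omega)

/-- A number has at most one cascade. -/
theorem eq_of_lower_eq {m : ℕ} : ∀ {p : ℕ} {T T' : Finset ℕ}, T ⊆ range m → T' ⊆ range m →
    Valid p T → Valid p T' → lower m p T = lower m p T' → T = T' := by
  induction m with
  | zero =>
    intro p T T' hT hT' _ _ _
    rw [subset_empty.1 hT, subset_empty.1 hT']
  | succ m ih =>
    have key : ∀ {p : ℕ} {T T' : Finset ℕ}, T ⊆ range m → T' ⊆ range m → Valid p T →
        Valid p (insert m T') → lower (m + 1) p T < lower (m + 1) p (insert m T') := by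
      intro p T T' hT hT' h h'
      obtain ⟨p, rfl⟩ := Nat.exists_eq_add_one_of_ne_zero (h'.pos_of_insert_top hT').ne'
      rw [lower_succ_insert p hT', lower_succ_of_subset _ hT]
      have h1 := lower_add_upper m (p + 1) T
      have h2 := upper_pos hT h ((valid_insert_top hT').1 h').1
      omega
    intro p T T' hTm hTm' h h' heq
    rcases subset_range_succ_cases hTm with hT | ⟨T, rfl, hT⟩ <;>
      rcases subset_range_succ_cases hTm' with hT' | ⟨T', rfl, hT'⟩
    · rw [lower_succ_of_subset _ hT, lower_succ_of_subset _ hT'] at heq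
      exact ih hT hT' h h' heq
    · exact absurd heq (key hT hT' h h').ne
    · exact absurd heq (key hT' hT h' h).ne'
    · obtain ⟨p, rfl⟩ := Nat.exists_eq_add_one_of_ne_zero (h'.pos_of_insert_top hT').ne'
      rw [lower_succ_insert p hT, lower_succ_insert p hT'] at heq
      rw [ih hT hT' ((valid_insert_top hT).1 h).2 ((valid_insert_top hT').1 h').2 (by omega)]

/-- Every number below `C(m, p)` has a cascade. -/
theorem exists_lower_eq {m : ℕ} : ∀ {p g : ℕ}, g < m.choose p →
    ∃ T ⊆ range m, Valid p T ∧ lower m p T = g := by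
  induction m with
  | zero =>
    intro p g hg
    have : g = 0 := by
      cases p <;> simp at hg
      exact hg
    exact ⟨∅, by simp, valid_empty p, by rw [lower_empty, this]⟩
  | succ m ih =>
    intro p g hg
    by_cases h : g < m.choose p
    · obtain ⟨T, hT, hv, he⟩ := ih h
      exact ⟨T, hT.trans (range_mono (Nat.le_succ m)), hv, by rw [lower_succ_of_subset _ hT, he]⟩
    cases p with
    | zero => simp at h hg; omega
    | succ p =>
      rw [Nat.choose_succ_succ'] at hg
      by_cases hp : p + 1 ≤ m
      · obtain ⟨T, hT, hv, he⟩ := @ih p (g - m.choose (p + 1)) (by omega)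
        exact ⟨insert m T, insert_top_subset hT, (valid_insert_top hT).2 ⟨hp, hv⟩,
          by rw [lower_succ_insert p hT, he]; omega⟩
      · have hg0 : g = 0 := by
          have h1 : m.choose p ≤ 1 := by
            rcases Nat.lt_or_ge m p with h2 | h2
            · simp [Nat.choose_eq_zero_of_lt h2]
            · have : m = p := by omega
              simp [this]
          have h3 : m.choose (p + 1) = 0 := Nat.choose_eq_zero_of_lt (by omega)
          omega
        exact ⟨∅, by simp, valid_empty _, by rw [lower_empty, hg0]⟩

theorem lower_singleton (m p : ℕ) : lower (m + 1) p {m} = m.choose p := by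
  rw [← insert_empty_eq]
  cases p with
  | zero => rw [lower_zero_insert, Nat.choose_zero_right]
  | succ p => rw [lower_succ_insert p (by simp), lower_empty, add_zero]

/-- The value of a cascade. -/
theorem lower_eq_sum {m : ℕ} : ∀ {p : ℕ} {T : Finset ℕ}, T ⊆ range m → T.card ≤ p →
    lower m p T = ∑ t ∈ T, t.choose (p - above T t) := by
  induction m with
  | zero =>
    intro p T hT _
    rw [subset_empty.1 hT, lower_empty, sum_empty]
  | succ m ih =>
    intro p T hTm hp
    rcases subset_range_succ_cases hTm with hT | ⟨T, rfl, hT⟩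
    · rw [lower_succ_of_subset _ hT, ih hT hp]
    · rw [card_insert_top hT] at hp
      obtain ⟨p, rfl⟩ := Nat.exists_eq_add_one_of_ne_zero (show p ≠ 0 by omega)
      rw [lower_succ_insert p hT, ih hT (by omega),
        sum_insert (fun h => by simpa using hT h), above_insert_top_self hT]
      congr 1
      refine sum_congr rfl fun t ht => ?_
      rw [above_insert_top hT (mem_range.1 (hT ht))]
      congr 1
      omega

/-- A set that does not precede `T`, whose least element is `a`, either agrees with `T` above `a`
and contains `a`, or first differs from `T` at an element outside `T` above `a`. -/
theorem upper_eq_sum {m : ℕ} : ∀ {q a : ℕ} {T : Finset ℕ}, T ⊆ range m → T.card ≤ q →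
    a ∈ T → (∀ t ∈ T, a ≤ t) →
    upper m q T = ∑ z ∈ (range m).filter (fun z => z = a ∨ (a < z ∧ z ∉ T)),
      z.choose (q - 1 - above T z) := by
  induction m with
  | zero =>
    intro q a T hT _ ha
    simpa using hT ha
  | succ m ih =>
    intro q a T hTm hq ha hmin
    rcases subset_range_succ_cases hTm with hT | ⟨T, rfl, hT⟩
    · have hq0 := card_pos.2 ⟨a, ha⟩
      obtain ⟨q, rfl⟩ := Nat.exists_eq_add_one_of_ne_zero (show q ≠ 0 by omega)
      rw [upper_succ_of_subset q hT, ih hT hq ha hmin, range_add_one, filter_insert,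
        if_pos (.inr ⟨mem_range.1 (hT ha), fun h => by simpa using hT h⟩),
        sum_insert (by simp), above_eq_zero hT (Nat.le_succ m)]
      rfl
    · rw [card_insert_top hT] at hq
      obtain ⟨q, rfl⟩ := Nat.exists_eq_add_one_of_ne_zero (show q ≠ 0 by omega)
      rw [upper_succ_insert q hT]
      rcases T.eq_empty_or_nonempty with rfl | ⟨b, hb⟩
      · have : a = m := by simpa using ha
        subst this
        have hS : (range (a + 1)).filter
            (fun z => z = a ∨ (a < z ∧ z ∉ insert a (∅ : Finset ℕ))) = {a} := by
          ext z
          simp only [mem_filter, mem_range, mem_singleton]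
          omega
        rw [hS, sum_singleton, above_insert_top_self hT, upper_empty]
        rfl
      · have hbm := mem_range.1 (hT hb)
        have ham : a < m := (hmin b (mem_insert_of_mem hb)).trans_lt hbm
        have haT : a ∈ T := mem_of_mem_insert_of_ne ha ham.ne
        rw [ih hT (by omega) haT (fun t ht => hmin t (mem_insert_of_mem ht)), range_add_one,
          filter_insert, if_neg (by simp [ham.ne'])]
        have hq0 := card_pos.2 ⟨a, haT⟩
        refine sum_congr ?_ fun z hz => ?_
        · refine filter_congr fun z hz => ?_
          have : z ≠ m := (mem_range.1 hz).ne
          simp [this]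
        · rw [above_insert_top hT (mem_range.1 (mem_filter.1 hz).1)]
          congr 1
          omega

/-! ### Moving the cut -/

/-- The sets of the two sizes `q ≤ r` are compared on the two sides of a cut of `{0, …, m - 1}`:
when `m ≤ q + r` the sets of size `q` are the more numerous ones below the cut, and when
`q + r ≤ m` the sets of size `r` are the more numerous ones above it. The two statements are
equivalent for `q + r = m`, and this lets one induction prove both. -/
theorem lower_le_lower_and_upper_le_upper {m : ℕ} : ∀ {q r : ℕ} {T : Finset ℕ}, T ⊆ range m →
    q ≤ r → (m ≤ q + r → lower m r T ≤ lower m q T) ∧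
      (q + r ≤ m → upper m q T ≤ upper m r T) := by
  induction m with
  | zero =>
    intro q r T hT hqr
    rw [subset_empty.1 hT]
    simp only [lower_empty, upper_empty, le_refl, implies_true, true_and]
    exact choose_le_choose_of_add_le hqr
  | succ m ih =>
    intro q r T hTm hqr
    have hq := lower_add_upper (m + 1) q T
    have hr := lower_add_upper (m + 1) r T
    rcases subset_range_succ_cases hTm with hT | ⟨T, rfl, hT⟩
    · have h1 : m + 1 ≤ q + r → lower (m + 1) r T ≤ lower (m + 1) q T := fun h => by
        rw [lower_succ_of_subset _ hT, lower_succ_of_subset _ hT]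
        exact (ih hT hqr).1 (by omega)
      refine ⟨h1, fun h => ?_⟩
      rcases h.eq_or_lt with h | h
      · have := h1 h.ge
        have := choose_eq_choose_of_add_eq h
        omega
      have h2 := (ih hT hqr).2 (by omega)
      cases q with
      | zero =>
        rw [upper_zero_of_subset hT]
        cases r with
        | zero => rw [upper_zero_of_subset hT]
        | succ r =>
          rw [upper_succ_of_subset _ hT]
          exact h2.trans (Nat.le_add_left _ _)
      | succ q =>
        cases r with
        | zero => omega
        | succ r =>
          rw [upper_succ_of_subset _ hT, upper_succ_of_subset _ hT]
          exact add_le_add (choose_le_choose_of_add_le (by omega) (by omega)) h2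
    · cases q with
      | zero =>
        rw [upper_zero_insert]
        refine ⟨fun h => ?_, fun _ => Nat.zero_le _⟩
        have := choose_le_choose_of_le_add (Nat.zero_le r) h
        rw [lower_zero_insert]
        simp only [Nat.choose_zero_right] at this
        omega
      | succ q =>
        cases r with
        | zero => omega
        | succ r =>
          have h1 : q + 1 + (r + 1) ≤ m + 1 →
              upper (m + 1) (q + 1) (insert m T) ≤ upper (m + 1) (r + 1) (insert m T) := fun h => by
            rw [upper_succ_insert _ hT, upper_succ_insert _ hT]
            exact (ih hT (by omega)).2 (by omega)
          refine ⟨fun h => ?_, h1⟩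
          rcases h.eq_or_lt with h | h
          · have := h1 h.ge
            have := choose_eq_choose_of_add_eq h.symm
            omega
          rw [lower_succ_insert _ hT, lower_succ_insert _ hT]
          exact add_le_add (choose_le_choose_of_le_add hqr (by omega))
            ((ih hT (by omega)).1 (by omega))

/-- Above a cut with slack the sets of size `q` outnumber those of size `r > q`. Every block above the
cut contributes at least as many of the former, and the block of the least element of the cut
contributes strictly more. -/
theorem upper_lt_upper_of_slack {m : ℕ} : ∀ {q r : ℕ} {T : Finset ℕ}, T ⊆ range m → q < r →
    T.Nonempty → Valid r T → Slack 3 (q + r) T → T.card ≤ q → m + 1 ≤ q + r →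
    upper m r T < upper m q T := by
  induction m with
  | zero =>
    intro q r T hT _ hne
    exact absurd (subset_empty.1 hT) hne.ne_empty
  | succ m ih =>
    intro q r T hTm hqr hne hv hs hc hm
    have hc0 := card_pos.2 hne
    obtain ⟨q, rfl⟩ := Nat.exists_eq_add_one_of_ne_zero (show q ≠ 0 by omega)
    obtain ⟨r, rfl⟩ := Nat.exists_eq_add_one_of_ne_zero (show r ≠ 0 by omega)
    rcases subset_range_succ_cases hTm with hT | ⟨T, rfl, hT⟩
    · rw [upper_succ_of_subset _ hT, upper_succ_of_subset _ hT]
      exact add_lt_add_of_le_of_lt (choose_le_choose_of_le_add (by omega) (by omega))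
        (ih hT hqr hne hv hs hc (by omega))
    · rw [upper_succ_insert _ hT, upper_succ_insert _ hT]
      rw [show q + 1 + (r + 1) = q + r + 2 by omega, slack_insert_top hT] at hs
      rw [valid_insert_top hT] at hv
      rw [card_insert_top hT] at hc
      rcases T.eq_empty_or_nonempty with rfl | hne
      · rw [upper_empty, upper_empty]
        exact choose_lt_choose_of_lt_add (by omega) (by omega) (by omega)
      · exact ih hT (by omega) hne hv.2 hs.2 (by omega) (by omega)

/-- Below a cut with slack the sets of size `q` are at least as many as those of size `r ≥ q`, block
by block. -/
theorem lower_le_lower_of_slack {m : ℕ} : ∀ {q r : ℕ} {T : Finset ℕ}, T ⊆ range m → q ≤ r →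
    Slack 2 (q + r) T → T.card ≤ q → lower m r T ≤ lower m q T := by
  induction m with
  | zero =>
    intro q r T hT _ _ _
    rw [subset_empty.1 hT, lower_empty, lower_empty]
  | succ m ih =>
    intro q r T hTm hqr hs hc
    rcases subset_range_succ_cases hTm with hT | ⟨T, rfl, hT⟩
    · rw [lower_succ_of_subset _ hT, lower_succ_of_subset _ hT]
      exact ih hT hqr hs hc
    · rw [card_insert_top hT] at hc
      obtain ⟨q, rfl⟩ := Nat.exists_eq_add_one_of_ne_zero (show q ≠ 0 by omega)
      obtain ⟨r, rfl⟩ := Nat.exists_eq_add_one_of_ne_zero (show r ≠ 0 by omega)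
      rw [show q + 1 + (r + 1) = q + r + 2 by omega, slack_insert_top hT] at hs
      rw [lower_succ_insert _ hT, lower_succ_insert _ hT]
      exact add_le_add (choose_le_choose_of_le_add hqr (by omega))
        (ih hT (by omega) hs.2 (by omega))

/-- Raising a cut from `T` to `T'` passes more sets of size `q` than sets of size `r`, if `T` and
`T'` have enough slack. Where `T` and `T'` first differ, the sets passed split into those above `T`
in the lower half of the block and those below `T'` in the upper half. -/
theorem lower_add_lower_lt {m : ℕ} : ∀ {q r : ℕ} {T T' : Finset ℕ}, T ⊆ range m → T' ⊆ range m →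
    q < r → Valid r T → Valid r T' → Slack 3 (q + r) T → Slack 2 (q + r) T' →
    T.card ≤ q → T'.card ≤ q → lower m r T < lower m r T' →
    lower m r T' + lower m q T < lower m q T' + lower m r T := by
  induction m with
  | zero =>
    intro q r T T' hT hT' _ _ _ _ _ _ _ h
    rw [subset_empty.1 hT, subset_empty.1 hT'] at h
    exact absurd h (lt_irrefl _)
  | succ m ih =>
    intro q r T T' hTm hTm' hqr hv hv' hs hs' hc hc' h
    rcases subset_range_succ_cases hTm with hT | ⟨T, rfl, hT⟩ <;>
      rcases subset_range_succ_cases hTm' with hT' | ⟨T', rfl, hT'⟩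
    · simp only [lower_succ_of_subset _ hT, lower_succ_of_subset _ hT'] at h ⊢
      exact ih hT hT' hqr hv hv' hs hs' hc hc' h
    · rw [card_insert_top hT'] at hc'
      obtain ⟨q, rfl⟩ := Nat.exists_eq_add_one_of_ne_zero (show q ≠ 0 by omega)
      obtain ⟨r, rfl⟩ := Nat.exists_eq_add_one_of_ne_zero (show r ≠ 0 by omega)
      have hs1 := hs'
      rw [show q + 1 + (r + 1) = q + r + 2 by omega, slack_insert_top hT'] at hs1
      rw [valid_insert_top hT'] at hv'
      simp only [lower_succ_of_subset _ hT, lower_succ_insert _ hT']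
      have h1 : lower m r T' ≤ lower m q T' :=
        lower_le_lower_of_slack hT' (by omega) hs1.2 (by omega)
      have h2 : upper m (r + 1) T < upper m (q + 1) T := by
        rcases T.eq_empty_or_nonempty with rfl | hne
        · rw [upper_empty, upper_empty]
          exact choose_lt_choose_of_lt_add (by omega) (by omega) (by omega)
        · exact upper_lt_upper_of_slack hT hqr hne hv hs hc (by omega)
      have h3 := lower_add_upper m (q + 1) T
      have h4 := lower_add_upper m (r + 1) T
      omega
    · obtain ⟨r, rfl⟩ := Nat.exists_eq_add_one_of_ne_zero (hv.pos_of_insert_top hT).ne'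
      rw [lower_succ_insert _ hT, lower_succ_of_subset _ hT'] at h
      have := lower_add_upper m (r + 1) T'
      omega
    · rw [card_insert_top hT] at hc
      rw [card_insert_top hT'] at hc'
      obtain ⟨q, rfl⟩ := Nat.exists_eq_add_one_of_ne_zero (show q ≠ 0 by omega)
      obtain ⟨r, rfl⟩ := Nat.exists_eq_add_one_of_ne_zero (show r ≠ 0 by omega)
      rw [show q + 1 + (r + 1) = q + r + 2 by omega, slack_insert_top hT] at hs
      rw [show q + 1 + (r + 1) = q + r + 2 by omega, slack_insert_top hT'] at hs'
      rw [valid_insert_top hT] at hv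
      rw [valid_insert_top hT'] at hv'
      simp only [lower_succ_insert _ hT, lower_succ_insert _ hT'] at h ⊢
      have := ih hT hT' (by omega) hv.2 hv'.2 hs.2 hs'.2 (by omega) (by omega) (by omega)
      omega

/-- A cut can be raised to one with slack, passing no more sets of size `q` than sets of size `r`;
the second alternative is that raising it above all of `{0, …, m - 1}` has this effect. A cut
without slack is raised to the end of the block where the slack condition first fails, and from
there it goes on upwards through the blocks on which the two sizes are equinumerous. -/
theorem exists_slack {m : ℕ} : ∀ {q r : ℕ} {T : Finset ℕ}, T ⊆ range m → Valid r T → q ≤ r →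
    m + 1 ≤ q + r →
    (∃ U ⊆ range m, Valid r U ∧ Slack 3 (q + r) U ∧ (T.Nonempty → U.Nonempty) ∧
      lower m r T ≤ lower m r U ∧
      lower m q U + lower m r T ≤ lower m q T + lower m r U) ∨
    upper m q T ≤ upper m r T := by
  induction m with
  | zero =>
    intro q r T hT hv _ _
    rw [subset_empty.1 hT]
    exact .inl ⟨∅, by simp, valid_empty _, slack_empty _ _, by simp, le_rfl, le_rfl⟩
  | succ m ih =>
    intro q r T hTm hv hqr hm
    rcases T.eq_empty_or_nonempty with rfl | hne
    · exact .inl ⟨∅, by simp, valid_empty _, slack_empty _ _, by simp, le_rfl, le_rfl⟩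
    rcases subset_range_succ_cases hTm with hT | ⟨T, rfl, hT⟩
    · rcases ih hT hv hqr (by omega) with ⟨U, hU, hUv, hUs, hUne, h1, h2⟩ | h
      · refine .inl ⟨U, hU.trans (range_mono (Nat.le_succ m)), hUv, hUs, hUne, ?_, ?_⟩ <;>
          simpa only [lower_succ_of_subset _ hT, lower_succ_of_subset _ hU]
      have hcard := card_pos.2 hne
      have hr0 : r ≠ 0 := by have := hv.1; omega
      have hrm := hv.le_of_nonempty hT hne
      obtain ⟨r, rfl⟩ := Nat.exists_eq_add_one_of_ne_zero hr0
      by_cases hm3 : m + 3 ≤ q + (r + 1)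
      · left
        refine ⟨{m}, by simp, ⟨by simp, fun t ht => ?_⟩, fun t ht => ?_, by simp, ?_, ?_⟩
        · rw [mem_singleton.1 ht]
          omega
        · rw [mem_singleton.1 ht, above_eq_zero (m := m + 1) (by simp) le_rfl]
          omega
        · rw [lower_singleton, lower_succ_of_subset _ hT]
          have := lower_add_upper m (r + 1) T
          omega
        · rw [lower_singleton, lower_singleton, lower_succ_of_subset _ hT,
            lower_succ_of_subset _ hT]
          have := lower_add_upper m (r + 1) T
          have := lower_add_upper m q T
          omega
      · right
        rw [upper_succ_of_subset _ hT]
        cases q with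
        | zero =>
          rw [upper_zero_of_subset hT]
          exact h.trans (Nat.le_add_left _ _)
        | succ q =>
          rw [upper_succ_of_subset _ hT]
          exact add_le_add (choose_eq_choose_of_add_eq (by omega)).le h
    · obtain ⟨r, rfl⟩ := Nat.exists_eq_add_one_of_ne_zero (hv.pos_of_insert_top hT).ne'
      rw [valid_insert_top hT] at hv
      cases q with
      | zero =>
        right
        rw [upper_zero_insert]
        exact Nat.zero_le _
      | succ q =>
        by_cases hm3 : m + 1 ≤ q + r
        · rcases ih hT hv.2 (by omega) hm3 with ⟨U, hU, hUv, hUs, -, h1, h2⟩ | h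
          · left
            refine ⟨insert m U, insert_top_subset hU, (valid_insert_top hU).2 ⟨hv.1, hUv⟩, ?_,
              fun _ => insert_nonempty _ _, ?_, ?_⟩
            · rw [show q + 1 + (r + 1) = q + r + 2 by omega, slack_insert_top hU]
              exact ⟨by omega, hUs⟩
            · rw [lower_succ_insert _ hT, lower_succ_insert _ hU]
              omega
            · simp only [lower_succ_insert _ hT, lower_succ_insert _ hU]
              omega
          · right
            rwa [upper_succ_insert _ hT, upper_succ_insert _ hT]
        · right
          rw [upper_succ_insert _ hT, upper_succ_insert _ hT]
          exact (lower_le_lower_and_upper_le_upper hT (by omega)).2 (by omega)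

/-- With slack, the requirement `|T| ≤ k - 1` on a resistant number is automatic. -/
theorem card_add_two_le_of_slack {q r : ℕ} {T : Finset ℕ} (hv : Valid r T)
    (hs : Slack 3 (q + r) T) (hne : T.Nonempty) : T.card + 2 ≤ q := by
  have hmem := T.min'_mem hne
  have h1 := hv.2 _ hmem
  have h2 := hs _ hmem
  have h3 : above T (T.min' hne) + 1 = T.card := by
    have : T.filter (fun u => T.min' hne < u) = T.erase (T.min' hne) := by
      ext u
      simp only [mem_filter, mem_erase]
      refine ⟨fun ⟨h, h'⟩ => ⟨h'.ne', h⟩, fun ⟨h, h'⟩ => ⟨h', ?_⟩⟩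
      exact lt_of_le_of_ne (T.min'_le u h') (Ne.symm h)
    rw [above, this, card_erase_add_one hmem]
  omega

/-! ### Cascade forms as cuts -/

/-- The image of a set under `b ↦ n - b`. It turns the lexicographic order into the colex order and
the set `{b₁ < b₂ < ⋯}` of a cascade form into the set of its upper indices `n - bᵢ`. -/
def reflect (n : ℕ) (T : Finset ℕ) : Finset ℕ := T.image (fun b => n - b)

section Reflect

variable {n : ℕ} {T : Finset ℕ}

theorem sub_mem_reflect (hT : ∀ b ∈ T, b < n) {a : ℕ} (ha : a < n) :
    n - a ∈ reflect n T ↔ a ∈ T := by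
  unfold reflect
  rw [mem_image]
  refine ⟨fun ⟨b, hb, h⟩ => ?_, fun h => ⟨a, h, rfl⟩⟩
  have := hT b hb
  rwa [show a = b by omega]

theorem reflect_injOn (hT : ∀ b ∈ T, b < n) : Set.InjOn (fun b => n - b) (T : Set ℕ) := by
  intro a ha b hb h
  have h1 := hT a ha
  have h2 := hT b hb
  simp only at h
  omega

theorem card_reflect (hT : ∀ b ∈ T, b < n) : (reflect n T).card = T.card :=
  card_image_of_injOn (reflect_injOn hT)

theorem reflect_reflect (hT : ∀ b ∈ T, b < n) : reflect n (reflect n T) = T := by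
  unfold reflect
  rw [image_image]
  conv_rhs => rw [← image_id (s := T)]
  refine image_congr fun b hb => ?_
  have := hT b hb
  simp only [Function.comp, id]
  omega

theorem reflect_subset_range (hT : ∀ b ∈ T, 1 ≤ b ∧ b < n) : reflect n T ⊆ range n := by
  intro t ht
  obtain ⟨b, hb, rfl⟩ := mem_image.1 ht
  have := hT b hb
  simp only [mem_range]
  omega

theorem above_reflect (hT : ∀ b ∈ T, b < n) {a : ℕ} (ha : a < n) :
    above (reflect n T) (n - a) = (T.filter (fun b => b < a)).card := by
  unfold above reflect
  rw [filter_image, card_image_of_injOn]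
  · congr 1
    refine filter_congr fun b hb => ?_
    have := hT b hb
    omega
  · exact (reflect_injOn hT).mono fun b hb => (mem_filter.1 hb).1

theorem pos_eq_of_mem {b : ℕ} (hb : b ∈ T) :
    pos T b = (T.filter (fun y => y < b)).card + 1 := by
  have : T.filter (fun y => y ≤ b) = insert b (T.filter (fun y => y < b)) := by
    ext y
    simp only [mem_filter, mem_insert]
    constructor
    · rintro ⟨h1, h2⟩
      rcases h2.eq_or_lt with h | h
      · exact .inl h
      · exact .inr ⟨h1, h⟩
    · rintro (rfl | ⟨h1, h2⟩)
      · exact ⟨hb, le_rfl⟩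
      · exact ⟨h1, h2.le⟩
  rw [pos, this, card_insert_of_notMem (by simp)]

theorem pos_eq_above_reflect (hT : ∀ b ∈ T, b < n) {b : ℕ} (hb : b ∈ T) :
    pos T b = above (reflect n T) (n - b) + 1 := by
  rw [pos_eq_of_mem hb, above_reflect hT (hT b hb)]

end Reflect

theorem isCascadeForm_iff {n k g : ℕ} {T : Finset ℕ} (hkn : k < n) :
    IsCascadeForm n k g T ↔ T.Nonempty ∧ (∀ b ∈ T, 1 ≤ b ∧ b < n) ∧
      Valid (n - k - 1) (reflect n T) ∧ g = lower n (n - k - 1) (reflect n T) := by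
  have hsum : (∀ b ∈ T, 1 ≤ b ∧ b < n) → T.card ≤ n - k - 1 →
      lower n (n - k - 1) (reflect n T) = ∑ b ∈ T, (n - b).choose (n - k - pos T b) := by
    intro hb hc
    have hlt : ∀ b ∈ T, b < n := fun b h => (hb b h).2
    rw [lower_eq_sum _ (by rwa [card_reflect hlt])]
    · rw [reflect, sum_image (reflect_injOn hlt)]
      refine sum_congr rfl fun b hb => ?_
      rw [← reflect, pos_eq_above_reflect hlt hb, Nat.sub_sub _ 1, Nat.add_comm 1]
    · exact reflect_subset_range hb
  constructor
  · intro h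
    have hb : ∀ b ∈ T, 1 ≤ b ∧ b < n := fun b hb => by
      have h1 := h.lower_le_upper b hb
      have h2 : pos T b ≤ T.card := card_filter_le _ _
      have h3 := h.card_lt
      exact ⟨h.one_le b hb, by omega⟩
    have hlt : ∀ b ∈ T, b < n := fun b h => (hb b h).2
    have hc := h.card_lt
    refine ⟨h.nonempty, hb, ⟨by rw [card_reflect hlt]; omega, fun t ht => ?_⟩, ?_⟩
    · obtain ⟨b, hbT, rfl⟩ := mem_image.1 ht
      have h1 := h.lower_le_upper b hbT
      have h2 := pos_eq_above_reflect hlt hbT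
      have h3 := hlt b hbT
      omega
    · rw [hsum hb (by omega)]
      exact h.sum_eq
  · rintro ⟨h1, h2, h3, h4⟩
    have hlt : ∀ b ∈ T, b < n := fun b h => (h2 b h).2
    have hc := h3.1
    rw [card_reflect hlt] at hc
    refine ⟨h1, fun b hb => (h2 b hb).1, by omega, fun b hb => ?_, by rw [h4, hsum h2 hc]⟩
    have h5 := h3.2 _ ((sub_mem_reflect hlt (hlt b hb)).2 hb)
    have h6 := pos_eq_above_reflect hlt hb
    omega

theorem slack_reflect_iff {n : ℕ} {T : Finset ℕ} (hn : 2 ≤ n) (hT : ∀ b ∈ T, b < n) :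
    Slack 3 (n - 2) (reflect n T) ↔ ∀ b ∈ T, 2 * pos T b + 2 < b := by
  unfold Slack
  rw [reflect, forall_mem_image, ← reflect]
  refine forall₂_congr fun b hb => ?_
  rw [pos_eq_above_reflect hT hb]
  have := hT b hb
  omega

theorem sup_mem {T : Finset ℕ} (hne : T.Nonempty) : T.sup id ∈ T := by
  obtain ⟨b, hb, h⟩ := exists_mem_eq_sup T hne id
  rw [h]
  exact hb

theorem pos_sup (T : Finset ℕ) : pos T (T.sup id) = T.card := by
  rw [pos, filter_true_of_mem]
  exact fun b hb => le_sup (f := id) hb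

theorem mem_complSet {T : Finset ℕ} {a : ℕ} :
    a ∈ complSet T ↔ a = T.sup id ∨ (2 ≤ a ∧ a ≤ T.sup id) ∧ a ∉ T := by
  simp [complSet]

/-- Up to an element `a` of the complementary set `S`, the interval `[2, a]` consists of the
elements of `S` and of the elements of `T` before `a`. -/
theorem pos_complSet_add {T : Finset ℕ} (hT : ∀ b ∈ T, 2 ≤ b) (hne : T.Nonempty) {a : ℕ}
    (ha : a ∈ complSet T) :
    pos (complSet T) a + (T.filter (fun b => b < a)).card = a - 1 := by
  have hs := sup_mem hne
  have hle : ∀ b ∈ T, b ≤ T.sup id := fun b hb => le_sup (f := id) hb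
  have ha' : a ≤ T.sup id := by
    rcases mem_complSet.1 ha with h | h
    · exact h.le
    · exact h.1.2
  rw [pos, ← card_union_of_disjoint]
  · have : (complSet T).filter (fun y => y ≤ a) ∪ T.filter (fun b => b < a) = Icc 2 a := by
      ext y
      simp only [mem_union, mem_filter, mem_Icc, mem_complSet]
      constructor
      · rintro (⟨rfl | h, h'⟩ | ⟨h, h'⟩)
        · exact ⟨hT _ hs, h'⟩
        · exact ⟨h.1.1, h'⟩
        · exact ⟨hT _ h, h'.le⟩
      · rintro ⟨h1, h2⟩
        by_cases hy : y ∈ T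
        · rcases h2.eq_or_lt with rfl | h
          · exact .inl ⟨(mem_complSet.1 ha).imp_right fun h => (h.2 hy).elim, le_rfl⟩
          · exact .inr ⟨hy, h⟩
        · exact .inl ⟨.inr ⟨⟨h1, h2.trans ha'⟩, hy⟩, h2⟩
    rw [this, Nat.card_Icc]
    omega
  · rw [disjoint_left]
    intro y h1 h2
    rw [mem_filter] at h1 h2
    rcases mem_complSet.1 h1.1 with rfl | h
    · omega
    · exact h.2 h2.1

theorem card_complSet_add {T : Finset ℕ} (hT : ∀ b ∈ T, 2 ≤ b) (hne : T.Nonempty) :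
    (complSet T).card + T.card = T.sup id := by
  have hs := sup_mem hne
  have h := pos_complSet_add hT hne (mem_complSet.2 (.inl rfl))
  have h1 : pos (complSet T) (T.sup id) = (complSet T).card := by
    rw [pos, filter_true_of_mem]
    intro a ha
    rcases mem_complSet.1 ha with h | h
    · exact h.le
    · exact h.1.2
  have h2 := pos_sup T
  rw [pos_eq_of_mem hs] at h2
  have := hT _ hs
  omega

theorem sup_le_of_valid {n k : ℕ} {T : Finset ℕ} (hkn : k < n) (hne : T.Nonempty)
    (hT : ∀ b ∈ T, b < n) (hv : Valid (n - k - 1) (reflect n T)) : T.sup id ≤ k + T.card := by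
  have hs := sup_mem hne
  have h1 := hv.2 _ ((sub_mem_reflect hT (hT _ hs)).2 hs)
  have h2 := pos_eq_above_reflect hT hs
  have h3 := hT _ hs
  rw [pos_sup] at h2
  omega

/-- The dual sum counts the sets that do not precede the cut. -/
theorem dualSum_complSet {n k : ℕ} {T : Finset ℕ} (hkn : 2 * k < n) (hne : T.Nonempty)
    (hT : ∀ b ∈ T, 2 ≤ b ∧ b < n) (hv : Valid (n - k - 1) (reflect n T)) (hc : T.card ≤ k - 1) :
    dualSum n k (complSet T) = upper (n - 1) (k - 1) (reflect n T) := by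
  have hlt : ∀ b ∈ T, b < n := fun b h => (hT b h).2
  have h2 : ∀ b ∈ T, 2 ≤ b := fun b h => (hT b h).1
  have hs := sup_mem hne
  have hsn := hlt _ hs
  have hle : ∀ b ∈ T, b ≤ T.sup id := fun b hb => le_sup (f := id) hb
  have hk := sup_le_of_valid (by omega) hne hlt hv
  have hcard := card_complSet_add h2 hne
  have hSle : ∀ a ∈ complSet T, 2 ≤ a ∧ a ≤ T.sup id := by
    intro a ha
    rcases mem_complSet.1 ha with h | h
    · exact ⟨h ▸ h2 _ hs, h.le⟩
    · exact h.1
  rw [upper_eq_sum (a := n - T.sup id)]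
  · have himg : (range (n - 1)).filter
        (fun z => z = n - T.sup id ∨ (n - T.sup id < z ∧ z ∉ reflect n T)) =
        (complSet T).image (fun a => n - a) := by
      ext z
      simp only [mem_filter, mem_range, mem_image]
      constructor
      · rintro ⟨h1, h3⟩
        refine ⟨n - z, mem_complSet.2 ?_, by omega⟩
        rcases h3 with h3 | ⟨h3, h4⟩
        · exact .inl (by omega)
        · refine .inr ⟨by omega, fun h => h4 ?_⟩
          rw [← sub_mem_reflect hlt (by omega)] at h
          rwa [show n - (n - z) = z by omega] at h
      · rintro ⟨a, ha, rfl⟩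
        have h5 := hSle a ha
        refine ⟨by omega, ?_⟩
        rcases mem_complSet.1 ha with h | h
        · exact .inl (by rw [h])
        · right
          rw [sub_mem_reflect hlt (by omega)]
          refine ⟨?_, h.2⟩
          have : a ≠ T.sup id := fun h6 => h.2 (h6 ▸ hs)
          omega
    rw [himg, sum_image]
    · unfold dualSum
      refine sum_congr rfl fun a ha => ?_
      have h5 := hSle a ha
      have h6 := pos_complSet_add h2 hne ha
      have h7 : pos (complSet T) a ≤ (complSet T).card := card_filter_le _ _
      have h8 : (T.filter (fun b => b < a)).card < T.card := by
        refine card_lt_card ((filter_ssubset).2 ⟨T.sup id, hs, by omega⟩)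
      rw [above_reflect hlt (by omega)]
      exact choose_eq_choose_of_add_eq (by omega)
    · exact reflect_injOn fun a ha => (hSle a ha).2.trans_lt hsn
  · intro t ht
    obtain ⟨b, hb, rfl⟩ := mem_image.1 ht
    have := hT b hb
    simp only [mem_range]
    omega
  · rwa [card_reflect hlt]
  · exact (sub_mem_reflect hlt hsn).2 hs
  · intro t ht
    obtain ⟨b, hb, rfl⟩ := mem_image.1 ht
    have := hle b hb
    omega

/-! ### Resistant cuts -/

/-- The cuts that correspond to the resistant numbers. The bounds on the cardinalities of the two
sets of a cascade form follow from the other requirements. The cut `{n - 4}` belongs to the number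
`C(n - 4, k - 3)`. -/
structure IsResistantCut (n k : ℕ) (U : Finset ℕ) : Prop where
  nonempty : U.Nonempty
  subset : U ⊆ range n
  valid : Valid (n - k - 1) U
  slack : Slack 3 (n - 2) U ∨ U = {n - 4}

section Cut

variable {n k : ℕ} {U : Finset ℕ}

theorem subset_range_of_slack (h : Slack 3 (n - 2) U) : U ⊆ range (n - 4) := by
  intro t ht
  have := h t ht
  rw [mem_range]
  omega

theorem IsResistantCut.subset_range (hn : 6 < n) (h : IsResistantCut n k U) :
    U ⊆ range (n - 3) := by
  rcases h.slack with h | rfl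
  · exact (subset_range_of_slack h).trans (range_mono (by omega))
  · simp
    omega

theorem IsResistantCut.slack_two (hn : 6 < n) (h : IsResistantCut n k U) :
    Slack 2 (n - 2) U := by
  rcases h.slack with h | rfl
  · exact h.mono (by omega)
  · intro t ht
    rw [mem_singleton.1 ht, above_eq_zero (m := n - 4 + 1) (by simp) le_rfl]
    omega

theorem IsResistantCut.card_le (hk : 3 ≤ k) (hn : 2 * k < n) (h : IsResistantCut n k U) :
    U.card ≤ k - 1 := by
  rcases h.slack with hs | rfl
  · rw [show n - 2 = k - 1 + (n - k - 1) by omega] at hs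
    have := card_add_two_le_of_slack h.valid hs h.nonempty
    omega
  · simp
    omega

theorem lower_singleton_sub_four (hk : 3 ≤ k) (hn : 2 * k < n) :
    lower n (n - k - 1) {n - 4} = (n - 4).choose (k - 3) := by
  rw [lower_of_subset_of_le (m := n - 4 + 1) _ (by simp) (by omega), lower_singleton]
  exact choose_eq_choose_of_add_eq (by omega)

theorem isResistantCut_singleton (hk : 3 ≤ k) (hn : 2 * k < n) : IsResistantCut n k {n - 4} where
  nonempty := by simp
  subset := by simp; omega
  valid := ⟨by simp; omega, fun t ht => by rw [mem_singleton.1 ht]; omega⟩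
  slack := .inr rfl

theorem IsResistantCut.lower_pos (h : IsResistantCut n k U) : 0 < lower n (n - k - 1) U := by
  rw [lower_eq_sum h.subset h.valid.1]
  obtain ⟨t, ht⟩ := h.nonempty
  refine sum_pos' (fun _ _ => Nat.zero_le _) ⟨t, ht, Nat.choose_pos ?_⟩
  have := h.valid.2 t ht
  omega

theorem IsResistantCut.lower_le (hk : 3 ≤ k) (hn : 2 * k < n) (h : IsResistantCut n k U) :
    lower n (n - k - 1) U ≤ (n - 4).choose (k - 3) := by
  rcases h.slack with hs | rfl
  · rw [lower_of_subset_of_le _ (subset_range_of_slack hs) (Nat.sub_le n 4),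
      choose_eq_choose_of_add_eq (show k - 3 + (n - k - 1) = n - 4 by omega),
      ← lower_add_upper]
    exact Nat.le_add_right _ _
  · exact (lower_singleton_sub_four hk hn).le

theorem above_lt_card {T : Finset ℕ} {t : ℕ} (ht : t ∈ T) : above T t < T.card :=
  card_lt_card (filter_ssubset.2 ⟨t, ht, lt_irrefl t⟩)

theorem bounds_of_mem_reflect (hU : U ⊆ range n) (hv : Valid (n - k - 1) U) :
    (∀ t ∈ U, t < n) ∧ ∀ b ∈ reflect n U, 1 ≤ b ∧ b < n := by
  refine ⟨fun t ht => mem_range.1 (hU ht), fun b hb => ?_⟩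
  obtain ⟨t, ht, rfl⟩ := mem_image.1 hb
  have h1 := mem_range.1 (hU ht)
  have h2 := hv.2 t ht
  have h3 := above_lt_card ht
  have h4 := hv.1
  omega

theorem isCascadeForm_reflect (hkn : k < n) (hne : U.Nonempty) (hU : U ⊆ range n)
    (hv : Valid (n - k - 1) U) : IsCascadeForm n k (lower n (n - k - 1) U) (reflect n U) := by
  obtain ⟨h1, h2⟩ := bounds_of_mem_reflect hU hv
  rw [isCascadeForm_iff hkn, reflect_reflect h1]
  exact ⟨hne.image _, h2, hv, rfl⟩

theorem IsResistantCut.isCascadeForm (hkn : k < n) (h : IsResistantCut n k U) :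
    IsCascadeForm n k (lower n (n - k - 1) U) (reflect n U) :=
  isCascadeForm_reflect hkn h.nonempty h.subset h.valid

/-- Cascade forms are unique. -/
theorem eq_reflect_of_isCascadeForm (hkn : k < n) (hU : U ⊆ range n)
    (hv : Valid (n - k - 1) U) {T : Finset ℕ}
    (hT : IsCascadeForm n k (lower n (n - k - 1) U) T) : T = reflect n U := by
  obtain ⟨-, h2, h3, h4⟩ := (isCascadeForm_iff hkn).1 hT
  rw [eq_of_lower_eq hU (reflect_subset_range h2) hv h3 h4, reflect_reflect fun b hb => (h2 b hb).2]

theorem isResistant_iff {g : ℕ} (hk : 3 ≤ k) (hn : 2 * k < n) :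
    IsResistant n k g ↔ ∃ U, IsResistantCut n k U ∧ lower n (n - k - 1) U = g := by
  constructor
  · rintro (⟨T, hT, -, -, h⟩ | rfl)
    · obtain ⟨h1, h2, h3, h4⟩ := (isCascadeForm_iff (by omega)).1 hT
      exact ⟨reflect n T, ⟨h1.image _, reflect_subset_range h2, h3,
        .inl ((slack_reflect_iff (by omega) fun b hb => (h2 b hb).2).2 h)⟩, h4.symm⟩
    · exact ⟨{n - 4}, isResistantCut_singleton hk hn, lower_singleton_sub_four hk hn⟩
  · rintro ⟨U, hU, rfl⟩
    rcases hU.slack with hs | rfl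
    · left
      obtain ⟨h1, h2⟩ := bounds_of_mem_reflect hU.subset hU.valid
      have h3 : ∀ b ∈ reflect n U, b < n := fun b hb => (h2 b hb).2
      have hne : (reflect n U).Nonempty := hU.nonempty.image _
      have hv := hU.valid
      have hc := hU.card_le hk hn
      rw [← reflect_reflect h1] at hs hv
      rw [slack_reflect_iff (by omega) h3] at hs
      have h4 := card_complSet_add (fun b hb => by have := hs b hb; omega) hne
      have h5 := sup_le_of_valid (by omega) hne h3 hv
      exact ⟨reflect n U, hU.isCascadeForm (by omega), by omega, by rwa [card_reflect h1], hs⟩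
    · exact .inr (lower_singleton_sub_four hk hn)

/-- The bound is the number of members of the intersecting family given by the cut. -/
theorem IsResistantCut.diversityBound_eq (hk : 3 ≤ k) (hn : 2 * k < n)
    (h : IsResistantCut n k U) (g : ℕ) :
    diversityBound n k g (reflect n U) = upper (n - 1) (k - 1) U + g := by
  obtain ⟨h1, h2⟩ := bounds_of_mem_reflect h.subset h.valid
  have h3 := h.subset_range (by omega)
  have h4 := dualSum_complSet (T := reflect n U) hn (h.nonempty.image _)
    (fun b hb => ⟨by
      obtain ⟨t, ht, rfl⟩ := mem_image.1 hb
      have := mem_range.1 (h3 ht)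
      omega, (h2 b hb).2⟩)
    (by rw [reflect_reflect h1]; exact h.valid)
    (by rw [card_reflect h1]; exact h.card_le hk hn)
  rw [reflect_reflect h1] at h4
  rw [diversityBound, h4]

/-- The bound decreases as the cut is raised. -/
theorem IsResistantCut.upper_add_lower_lt (hk : 3 ≤ k) (hn : 2 * k < n) {U' : Finset ℕ}
    (h : IsResistantCut n k U) (h' : IsResistantCut n k U')
    (hlt : lower n (n - k - 1) U < lower n (n - k - 1) U') :
    upper (n - 1) (k - 1) U' + lower n (n - k - 1) U' <
      upper (n - 1) (k - 1) U + lower n (n - k - 1) U := by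
  have hs : Slack 3 (n - 2) U := by
    rcases h.slack with hs | rfl
    · exact hs
    · rw [lower_singleton_sub_four hk hn] at hlt
      exact absurd (h'.lower_le hk hn) (not_le.2 hlt)
  have hs' := h'.slack_two (by omega)
  have hU : U ⊆ range (n - 1) := (h.subset_range (by omega)).trans (range_mono (by omega))
  have hU' : U' ⊆ range (n - 1) := (h'.subset_range (by omega)).trans (range_mono (by omega))
  rw [show n - 2 = k - 1 + (n - k - 1) by omega] at hs hs'
  rw [lower_of_subset_of_le _ hU (Nat.sub_le n 1),
    lower_of_subset_of_le _ hU' (Nat.sub_le n 1)] at hlt ⊢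
  have h1 := lower_add_lower_lt hU hU' (by omega) h.valid h'.valid hs hs' (h.card_le hk hn)
    (h'.card_le hk hn) hlt
  have h2 := lower_add_upper (n - 1) (k - 1) U
  have h3 := lower_add_upper (n - 1) (k - 1) U'
  omega

/-- Every cut that is not too high can be raised to a resistant one, without decreasing the size of
the family it gives. -/
theorem exists_isResistantCut (hk : 3 ≤ k) (hn : 2 * k < n) {g : ℕ} (hg0 : 0 < g)
    (hg : g ≤ (n - 4).choose (k - 3)) :
    ∃ T ⊆ range (n - 1), Valid (n - k - 1) T ∧ lower (n - 1) (n - k - 1) T = g ∧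
      ∃ U, IsResistantCut n k U ∧ g ≤ lower n (n - k - 1) U ∧
        upper (n - 1) (k - 1) T + g ≤ upper (n - 1) (k - 1) U + lower n (n - k - 1) U := by
  have hsing := lower_singleton_sub_four hk hn
  have hsub : {n - 4} ⊆ range (n - 1) := by simp; omega
  have hsing' := hsing
  rw [lower_of_subset_of_le _ hsub (Nat.sub_le n 1)] at hsing'
  rcases hg.eq_or_lt with rfl | hg
  · exact ⟨{n - 4}, hsub, (isResistantCut_singleton hk hn).valid, hsing', {n - 4},
      isResistantCut_singleton hk hn, hsing.ge, by rw [hsing]⟩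
  rw [choose_eq_choose_of_add_eq (show k - 3 + (n - k - 1) = n - 4 by omega)] at hg
  obtain ⟨T, hT, hv, hl⟩ := exists_lower_eq hg
  have hr : ∀ {c}, n - 4 ≤ c → range (n - 4) ⊆ range c := fun hc => range_mono hc
  have hne : T.Nonempty := by
    rw [nonempty_iff_ne_empty]
    rintro rfl
    rw [lower_empty] at hl
    omega
  have hlT : ∀ {c} p, n - 4 ≤ c → lower c p T = lower (n - 4) p T :=
    fun p hc => lower_of_subset_of_le p hT hc
  refine ⟨T, hT.trans (hr (by omega)), hv, by rw [hlT _ (by omega), hl], ?_⟩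
  have e1 := lower_add_upper (n - 1) (k - 1) T
  rw [hlT _ (by omega)] at e1
  rcases exists_slack (q := k - 1) hT hv (by omega) (by omega) with
    ⟨U, hU, hUv, hUs, hUne, h1, h2⟩ | h
  · rw [show k - 1 + (n - k - 1) = n - 2 by omega] at hUs
    refine ⟨U, ⟨hUne hne, hU.trans (hr (by omega)), hUv, .inl hUs⟩, ?_, ?_⟩
    · rwa [lower_of_subset_of_le _ hU (by omega), ← hl]
    · have e2 := lower_add_upper (n - 1) (k - 1) U
      rw [lower_of_subset_of_le _ hU (by omega)] at e2 ⊢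
      omega
  · refine ⟨{n - 4}, isResistantCut_singleton hk hn, ?_, ?_⟩
    · rw [hsing, choose_eq_choose_of_add_eq (show k - 3 + (n - k - 1) = n - 4 by omega)]
      exact hg.le
    · have e2 := lower_add_upper (n - 1) (k - 1) {n - 4}
      have e3 := lower_add_upper (n - 4) (k - 1) T
      have e4 := lower_add_upper (n - 4) (n - k - 1) T
      rw [lower_of_subset_of_le (m := n - 4 + 1) _ (by simp) (by omega), lower_singleton] at e2
      rw [hsing, choose_eq_choose_of_add_eq (show k - 3 + (n - k - 1) = n - 4 by omega)]
      omega

end Cut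

/-! ### The Kruskal–Katona bound for cross-intersecting families -/

theorem lowerFamily_eq_map (N p : ℕ) (T : Finset ℕ) :
    lowerFamily N p T = ((powersetCard p (univ : Finset (Fin N))).filter
      (fun X => toColex (X.map Fin.valEmbedding) < toColex T)).map
        (mapEmbedding Fin.valEmbedding).toEmbedding := by
  have h : range N = (univ : Finset (Fin N)).map Fin.valEmbedding := by
    rw [Fin.map_valEmbedding_univ, Nat.Iio_eq_range]
  rw [lowerFamily, h, powersetCard_map, filter_map]
  rfl

/-- The sets of size `q` below a cut lie in the iterated shadow of those of size `r ≥ q`. -/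
theorem exists_superset_mem_lowerFamily {N q r : ℕ} {T Y : Finset ℕ} (hT : T ⊆ range N)
    (hv : Valid r T) (hqr : q ≤ r) (hY : Y ∈ lowerFamily N q T) :
    ∃ X ∈ lowerFamily N r T, Y ⊆ X := by
  rw [lowerFamily, mem_filter, mem_powersetCard, Colex.lt_iff_exists_filter_lt] at hY
  obtain ⟨⟨hYN, hYq⟩, w, hw, hwY⟩ := hY
  rw [mem_sdiff] at hw
  have h1 : (Y.filter (fun u => w < u)).card = above T w := by rw [hwY, above]
  have h2 : (Y.filter (fun u => u < w)).card + above T w = q := by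
    rw [← h1, ← hYq, ← card_union_of_disjoint]
    · congr 1
      ext u
      simp only [mem_union, mem_filter, ← and_or_left, and_iff_left_iff_imp]
      exact fun hu => lt_or_gt_of_ne fun h => hw.2 (h ▸ hu)
    · rw [disjoint_left]
      intro u hu hu'
      exact lt_asymm (mem_filter.1 hu).2 (mem_filter.1 hu').2
  have h3 : (range w \ Y).card + (Y.filter (fun u => u < w)).card = w := by
    have : Y.filter (fun u => u < w) = range w ∩ Y := by
      ext u
      simp [and_comm]
    rw [this, card_sdiff_add_card_inter, card_range]
  have h4 := hv.2 w hw.1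
  obtain ⟨Z, hZ, hZc⟩ := exists_subset_card_eq (show r - q ≤ (range w \ Y).card by omega)
  have hZw : ∀ z ∈ Z, z < w := fun z hz => mem_range.1 (mem_sdiff.1 (hZ hz)).1
  have hwN := mem_range.1 (hT hw.1)
  refine ⟨Y ∪ Z, ?_, subset_union_left⟩
  rw [lowerFamily, mem_filter, mem_powersetCard, Colex.toColex_lt_toColex_iff_exists_forall_lt]
  refine ⟨⟨union_subset hYN fun z hz => mem_range.2 ((hZw z hz).trans hwN), ?_⟩, w, hw.1, ?_, ?_⟩
  · rw [card_union_of_disjoint, hYq, hZc]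
    · omega
    · exact disjoint_left.2 fun u hu hu' => (mem_sdiff.1 (hZ hu')).2 hu
  · rw [mem_union]
    rintro (h | h)
    · exact hw.2 h
    · exact lt_irrefl _ (hZw w h)
  · intro b hb hbT
    rcases mem_union.1 hb with hb | hb
    · by_contra hbw
      have hne : b ≠ w := fun h => hw.2 (h ▸ hb)
      have : b ∈ Y.filter (fun u => w < u) := mem_filter.2 ⟨hb, by omega⟩
      rw [hwY] at this
      exact hbT (mem_filter.1 this).1
    · exact hZw b hb

/-- If no member of `𝒜` is contained in a member of `ℬ`, then `𝒜` avoids the iterated shadow of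
`ℬ`, which by the Kruskal–Katona theorem is at least as large as the iterated shadow of an initial
segment of the colex order. -/
theorem card_le_upper {N q r : ℕ} {𝒜 ℬ : Finset (Finset (Fin N))} {T : Finset ℕ}
    (hA : ∀ Y ∈ 𝒜, Y.card = q) (hB : ∀ X ∈ ℬ, X.card = r) (hAB : ∀ Y ∈ 𝒜, ∀ X ∈ ℬ, ¬ Y ⊆ X)
    (hqr : q ≤ r) (hT : T ⊆ range N) (hv : Valid r T) (hl : lower N r T ≤ ℬ.card) :
    𝒜.card ≤ upper N q T := by
  set C : ℕ → Finset (Finset (Fin N)) := fun p => (powersetCard p (univ : Finset (Fin N))).filter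
    (fun X => toColex (X.map Fin.valEmbedding) < toColex T) with hC
  have hcard : ∀ p, (C p).card = lower N p T := fun p => by
    rw [lower, lowerFamily_eq_map, card_map]
  have hinit : Colex.IsInitSeg (C r) r := by
    refine ⟨fun X hX => (mem_powersetCard.1 (mem_filter.1 hX).1).2, ?_⟩
    rintro s t hs ⟨hts, htr⟩
    refine mem_filter.2 ⟨mem_powersetCard.2 ⟨subset_univ _, htr⟩, ?_⟩
    refine lt_trans ?_ (mem_filter.1 hs).2
    rw [map_eq_image, map_eq_image]
    exact (Colex.toColex_image_lt_toColex_image Fin.val_strictMono).2 hts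
  have hkk := iterated_kk (k := r - q) (𝒜 := ℬ) (fun X hX => hB X hX) (by rwa [hcard]) hinit
  have hsub : C q ⊆ ∂^[r - q] (C r) := by
    intro Y hY
    have hY' : Y.map Fin.valEmbedding ∈ lowerFamily N q T := by
      rw [lowerFamily_eq_map]
      exact mem_map_of_mem _ hY
    obtain ⟨X, hX, hYX⟩ := exists_superset_mem_lowerFamily hT hv hqr hY'
    rw [lowerFamily_eq_map, mem_map] at hX
    obtain ⟨X, hX, rfl⟩ := hX
    rw [mem_shadow_iterate_iff_exists_mem_card_add]
    refine ⟨X, hX, map_subset_map.1 hYX, ?_⟩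
    rw [hinit.1 hX, (mem_powersetCard.1 (mem_filter.1 hY).1).2]
    omega
  have h1 : lower N q T ≤ (∂^[r - q] ℬ).card := by
    rw [← hcard]
    exact (card_le_card hsub).trans hkk
  have h2 : 𝒜.card + (∂^[r - q] ℬ).card ≤ N.choose q := by
    rw [← card_union_of_disjoint]
    · calc (𝒜 ∪ ∂^[r - q] ℬ).card ≤ (powersetCard q (univ : Finset (Fin N))).card := by
            refine card_le_card (union_subset ?_ ?_) <;> intro Y hY <;>
              refine mem_powersetCard.2 ⟨subset_univ _, ?_⟩
            · exact hA Y hY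
            · rw [mem_shadow_iterate_iff_exists_mem_card_add] at hY
              obtain ⟨X, hX, -, hc⟩ := hY
              rw [hB X hX] at hc
              omega
        _ = N.choose q := by rw [card_powersetCard, card_univ, Fintype.card_fin]
    · rw [disjoint_left]
      intro Y hY hY'
      rw [mem_shadow_iterate_iff_exists_mem_card_add] at hY'
      obtain ⟨X, hX, hYX, -⟩ := hY'
      exact hAB Y hY X hX hYX
  have h3 := lower_add_upper N q T
  omega

/-! ### Intersecting families and their links -/

section Link

variable {N : ℕ} (i : Fin (N + 1))

/-- The set `Y` of the remaining ground set, with `i` added. -/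
def addPoint (Y : Finset (Fin N)) : Finset (Fin (N + 1)) := insert i (Y.map i.succAboveEmb)

/-- The complement of `X` in the ground set without `i`. -/
def coPoint (X : Finset (Fin N)) : Finset (Fin (N + 1)) := Xᶜ.map i.succAboveEmb

variable {i}

theorem mem_addPoint {Y : Finset (Fin N)} {x : Fin N} :
    i.succAbove x ∈ addPoint i Y ↔ x ∈ Y := by
  simp [addPoint, Fin.succAbove_ne]

theorem mem_coPoint {X : Finset (Fin N)} {x : Fin N} :
    i.succAbove x ∈ coPoint i X ↔ x ∉ X := by
  simp [coPoint]

theorem self_mem_addPoint (Y : Finset (Fin N)) : i ∈ addPoint i Y := mem_insert_self _ _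

theorem self_notMem_coPoint (X : Finset (Fin N)) : i ∉ coPoint i X := by
  simp [coPoint, Fin.succAbove_ne]

theorem card_addPoint (Y : Finset (Fin N)) : (addPoint i Y).card = Y.card + 1 := by
  rw [addPoint, card_insert_of_notMem, card_map]
  simp [Fin.succAbove_ne]

theorem card_coPoint (X : Finset (Fin N)) : (coPoint i X).card + X.card = N := by
  rw [coPoint, card_map, card_compl_add_card, Fintype.card_fin]

theorem addPoint_injective : Function.Injective (addPoint i) := fun Y Y' h => by
  ext x
  rw [← mem_addPoint (i := i), h, mem_addPoint]

theorem coPoint_injective : Function.Injective (coPoint i) := fun X X' h => by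
  ext x
  rw [← not_iff_not, ← mem_coPoint (i := i), h, mem_coPoint]

theorem exists_addPoint_eq {Z : Finset (Fin (N + 1))} (hZ : i ∈ Z) : ∃ Y, addPoint i Y = Z := by
  refine ⟨univ.filter (fun x => i.succAbove x ∈ Z), ?_⟩
  ext z
  rcases Fin.eq_self_or_eq_succAbove i z with rfl | ⟨x, rfl⟩
  · simp [self_mem_addPoint, hZ]
  · rw [mem_addPoint]
    simp

theorem exists_coPoint_eq {Z : Finset (Fin (N + 1))} (hZ : i ∉ Z) : ∃ X, coPoint i X = Z := by
  refine ⟨univ.filter (fun x => i.succAbove x ∉ Z), ?_⟩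
  ext z
  rcases Fin.eq_self_or_eq_succAbove i z with rfl | ⟨x, rfl⟩
  · simp [self_notMem_coPoint, hZ]
  · rw [mem_coPoint]
    simp

theorem not_subset_iff_inter_nonempty {X Y : Finset (Fin N)} :
    (addPoint i Y ∩ coPoint i X).Nonempty ↔ ¬ Y ⊆ X := by
  rw [not_subset]
  constructor
  · rintro ⟨z, hz⟩
    rw [mem_inter] at hz
    rcases Fin.eq_self_or_eq_succAbove i z with rfl | ⟨x, rfl⟩
    · exact absurd hz.2 (self_notMem_coPoint _)
    · exact ⟨x, mem_addPoint.1 hz.1, mem_coPoint.1 hz.2⟩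
  · rintro ⟨x, h1, h2⟩
    exact ⟨i.succAbove x, mem_inter.2 ⟨mem_addPoint.2 h1, mem_coPoint.2 h2⟩⟩

end Link

theorem exists_maxDegree_eq {N : ℕ} (F : Finset (Finset (Fin (N + 1)))) :
    ∃ i, maxDegree F = (F.filter (fun A => i ∈ A)).card := by
  obtain ⟨i, -, h⟩ := exists_mem_eq_sup univ univ_nonempty
    (fun i : Fin (N + 1) => (F.filter (fun A => i ∈ A)).card)
  exact ⟨i, h⟩

/-- The members of an intersecting family that contain an element `i` of maximal degree and the
complements of those that do not are subject to `card_le_upper`. -/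
theorem card_le_of_isIntersectingFamily {n k : ℕ} (hk : 0 < k) (hn : 2 * k < n)
    {F : Finset (Finset (Fin n))} (hF : IsIntersectingFamily n k F) {T : Finset ℕ}
    (hT : T ⊆ range (n - 1)) (hv : Valid (n - k - 1) T)
    (hl : lower (n - 1) (n - k - 1) T = diversity F) :
    F.card ≤ upper (n - 1) (k - 1) T + diversity F := by
  obtain ⟨N, rfl⟩ := Nat.exists_eq_add_one_of_ne_zero (show n ≠ 0 by omega)
  obtain ⟨i, hi⟩ := exists_maxDegree_eq F
  have hsplit := card_filter_add_card_filter_not (s := F) (fun A => i ∈ A)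
  have hdiv : diversity F = (F.filter (fun A => i ∉ A)).card := by
    rw [diversity, hi]
    omega
  have hsize : ∀ Z ∈ F, Z.card = k := fun Z hZ => (mem_powersetCard.1 (hF.1 hZ)).2
  set 𝒜 : Finset (Finset (Fin N)) := univ.filter (fun Y => addPoint i Y ∈ F)
  set ℬ : Finset (Finset (Fin N)) := univ.filter (fun X => coPoint i X ∈ F)
  have hA : (F.filter (fun A => i ∈ A)).card ≤ 𝒜.card := by
    refine (card_le_card (t := 𝒜.image (addPoint i)) fun Z hZ => ?_).trans card_image_le
    rw [mem_filter] at hZ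
    obtain ⟨Y, rfl⟩ := exists_addPoint_eq hZ.2
    exact mem_image_of_mem _ (mem_filter.2 ⟨mem_univ _, hZ.1⟩)
  have hB : (F.filter (fun A => i ∉ A)).card ≤ ℬ.card := by
    refine (card_le_card (t := ℬ.image (coPoint i)) fun Z hZ => ?_).trans card_image_le
    rw [mem_filter] at hZ
    obtain ⟨Y, rfl⟩ := exists_coPoint_eq hZ.2
    exact mem_image_of_mem _ (mem_filter.2 ⟨mem_univ _, hZ.1⟩)
  have h := card_le_upper (𝒜 := 𝒜) (ℬ := ℬ) (q := k - 1) (r := N + 1 - k - 1) (T := T) (N := N)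
    (fun Y hY => by
      have h1 := hsize _ (mem_filter.1 hY).2
      rw [card_addPoint] at h1
      omega)
    (fun X hX => by
      have h1 := hsize _ (mem_filter.1 hX).2
      have h2 := card_coPoint (i := i) X
      omega)
    (fun Y hY X hX => not_subset_iff_inter_nonempty.1
      (hF.2 _ (mem_filter.1 hY).2 _ (mem_filter.1 hX).2))
    (by omega) hT hv (by rw [← hdiv, ← hl] at hB; exact hB)
  simp only [Nat.add_sub_cancel] at h ⊢
  omega

/-! ### Sharpness -/

/-- Every resistant cut `U` gives an intersecting family: the sets not below `U` with a new element
`0` added, together with the complements of the sets below `U`. The latter all contain the two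
largest elements, so that they pairwise intersect and the element `0` has maximal degree. -/
theorem IsResistantCut.exists_isIntersectingFamily {n k : ℕ} {U : Finset ℕ} (hk : 3 ≤ k)
    (hn : 2 * k < n) (hU : IsResistantCut n k U) :
    ∃ F : Finset (Finset (Fin n)), IsIntersectingFamily n k F ∧
      diversity F = lower n (n - k - 1) U ∧
      F.card = upper (n - 1) (k - 1) U + lower n (n - k - 1) U := by
  have hU3 := hU.subset_range (by omega)
  have hle := hU.lower_le hk hn
  rw [lower_of_subset_of_le _ (hU3.trans (range_mono (show n - 3 ≤ n - 1 by omega)))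
    (Nat.sub_le n 1)] at hle ⊢
  obtain ⟨N, rfl⟩ := Nat.exists_eq_add_one_of_ne_zero (show n ≠ 0 by omega)
  simp only [Nat.add_sub_cancel] at hle ⊢
  set r := N + 1 - k - 1 with hr
  set φ : Finset (Fin N) → Colex (Finset ℕ) := fun X => toColex (X.map Fin.valEmbedding) with hφ
  set 𝒜 : Finset (Finset (Fin N)) :=
    (powersetCard (k - 1) univ).filter (fun Y => ¬ φ Y < toColex U) with hA
  set ℬ : Finset (Finset (Fin N)) :=
    (powersetCard r univ).filter (fun X => φ X < toColex U) with hB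
  have hBcard : ℬ.card = lower N r U := by rw [lower, lowerFamily_eq_map, card_map]
  have hAcard : 𝒜.card = upper N (k - 1) U := by
    have h1 := lower_add_upper N (k - 1) U
    have h2 : ((powersetCard (k - 1) univ).filter (fun Y => φ Y < toColex U)).card + 𝒜.card =
        (powersetCard (k - 1) (univ : Finset (Fin N))).card :=
      card_filter_add_card_filter_not _
    rw [card_powersetCard, card_univ, Fintype.card_fin] at h2
    have h3 : ((powersetCard (k - 1) univ).filter (fun Y => φ Y < toColex U)).card =
        lower N (k - 1) U := by
      rw [lower, lowerFamily_eq_map, card_map]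
    omega
  -- a set that contains one of the two largest elements is not below the cut
  have htop : ∀ X : Finset (Fin N), ∀ y ∈ X, N ≤ y.val + 2 → ¬ φ X < toColex U := by
    intro X y hy hyN h
    have := Colex.forall_lt_mono h.le (fun b hb => mem_range.1 (hU3 hb)) y
      (mem_map_of_mem Fin.valEmbedding hy)
    omega
  let i : Fin (N + 1) := 0
  set F := 𝒜.image (addPoint i) ∪ ℬ.image (coPoint i) with hF
  have hdisj : Disjoint (𝒜.image (addPoint i)) (ℬ.image (coPoint i)) := by
    rw [disjoint_left]
    intro Z h1 h2
    obtain ⟨Y, -, rfl⟩ := mem_image.1 h1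
    obtain ⟨X, -, h⟩ := mem_image.1 h2
    exact self_notMem_coPoint (i := i) X (h ▸ self_mem_addPoint Y)
  have hFcard : F.card = 𝒜.card + ℬ.card := by
    rw [hF, card_union_of_disjoint hdisj, card_image_of_injective _ addPoint_injective,
      card_image_of_injective _ coPoint_injective]
  have hdegi : (F.filter (fun Z => i ∈ Z)).card = 𝒜.card := by
    rw [hF, filter_union, filter_true_of_mem, filter_false_of_mem, union_empty,
      card_image_of_injective _ addPoint_injective]
    · simp [self_notMem_coPoint]
    · simp [self_mem_addPoint]
  have hdeg : ∀ x : Fin N, (F.filter (fun Z => i.succAbove x ∈ Z)).card ≤ 𝒜.card := by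
    intro x
    obtain ⟨y, hyx, hyN⟩ : ∃ y : Fin N, y ≠ x ∧ N ≤ y.val + 2 := by
      by_cases hx : x.val = N - 1
      · exact ⟨⟨N - 2, by omega⟩, fun h => by rw [← h] at hx; simp at hx; omega, by simp; omega⟩
      · exact ⟨⟨N - 1, by omega⟩, fun h => hx (by rw [← h]), by simp; omega⟩
    have h1 : ℬ.card ≤ (𝒜.filter (fun Y => x ∉ Y)).card := by
      have h2 : ((powersetCard (k - 2) ((univ.erase x).erase y)).image (insert y)).card =
          (N - 2).choose (k - 2) := by
        rw [card_image_of_injOn, card_powersetCard, card_erase_of_mem, card_erase_of_mem,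
          card_univ, Fintype.card_fin, Nat.sub_sub]
        · exact mem_univ _
        · exact mem_erase.2 ⟨hyx, mem_univ _⟩
        · intro P hP Q hQ hPQ
          have hP' : y ∉ P := fun h => notMem_erase y _ ((mem_powersetCard.1 hP).1 h)
          have hQ' : y ∉ Q := fun h => notMem_erase y _ ((mem_powersetCard.1 hQ).1 h)
          rw [← erase_insert hP', ← erase_insert hQ']
          exact congrArg (fun Z => erase Z y) hPQ
      calc ℬ.card ≤ (N - 3).choose (k - 3) := by rw [hBcard]; exact hle
        _ ≤ (N - 2).choose (k - 2) := by
          rw [show N - 2 = N - 3 + 1 by omega, show k - 2 = k - 3 + 1 by omega,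
            Nat.choose_succ_succ']
          exact Nat.le_add_right _ _
        _ ≤ _ := by
          rw [← h2]
          refine card_le_card fun Y hY => ?_
          obtain ⟨P, hP, rfl⟩ := mem_image.1 hY
          rw [mem_powersetCard] at hP
          have hyP : y ∉ P := fun h => notMem_erase y _ (hP.1 h)
          have hxP : x ∉ P := fun h => notMem_erase x _ (mem_of_mem_erase (hP.1 h))
          refine mem_filter.2 ⟨mem_filter.2 ⟨mem_powersetCard.2 ⟨subset_univ _, ?_⟩,
            htop _ y (mem_insert_self _ _) hyN⟩, ?_⟩
          · rw [card_insert_of_notMem hyP, hP.2]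
            omega
          · rw [mem_insert, not_or]
            exact ⟨hyx.symm, hxP⟩
    have h2 : (F.filter (fun Z => i.succAbove x ∈ Z)).card ≤
        (𝒜.filter (fun Y => x ∈ Y)).card + ℬ.card := by
      rw [hF, filter_union]
      refine (card_union_le _ _).trans (add_le_add ?_ ?_)
      · rw [filter_image]
        refine card_image_le.trans (card_le_card fun Y hY => ?_)
        rw [mem_filter, mem_addPoint] at hY
        exact mem_filter.2 hY
      · exact (card_filter_le _ _).trans card_image_le
    have h3 := card_filter_add_card_filter_not (s := 𝒜) (fun Y => x ∈ Y)
    omega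
  have hmax : maxDegree F = 𝒜.card := by
    refine le_antisymm (Finset.sup_le fun z _ => ?_) ?_
    · rcases Fin.eq_self_or_eq_succAbove i z with rfl | ⟨x, rfl⟩
      · exact hdegi.le
      · exact hdeg x
    · rw [← hdegi]
      exact le_sup (f := fun j : Fin (N + 1) => (F.filter (fun A => j ∈ A)).card) (mem_univ i)
  refine ⟨F, ⟨fun Z hZ => mem_powersetCard.2 ⟨subset_univ _, ?_⟩, ?_⟩, ?_, by
    rw [hFcard, hAcard, hBcard]⟩
  · rcases mem_union.1 hZ with h | h
    · obtain ⟨Y, hY, rfl⟩ := mem_image.1 h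
      rw [card_addPoint, (mem_powersetCard.1 (mem_filter.1 hY).1).2]
      omega
    · obtain ⟨X, hX, rfl⟩ := mem_image.1 h
      have h1 := card_coPoint (i := i) X
      have h2 := (mem_powersetCard.1 (mem_filter.1 hX).1).2
      omega
  · have hcross : ∀ Y ∈ 𝒜, ∀ X ∈ ℬ, ¬ Y ⊆ X := by
      intro Y hY X hX hYX
      refine (mem_filter.1 hY).2 (lt_of_le_of_lt ?_ (mem_filter.1 hX).2)
      exact Colex.toColex_le_toColex_of_subset (map_subset_map.2 hYX)
    intro Z hZ W hW
    rcases mem_union.1 hZ with hZ | hZ <;> rcases mem_union.1 hW with hW | hW <;>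
      obtain ⟨P, hP, rfl⟩ := mem_image.1 hZ <;> obtain ⟨Q, hQ, rfl⟩ := mem_image.1 hW
    · exact ⟨i, mem_inter.2 ⟨self_mem_addPoint _, self_mem_addPoint _⟩⟩
    · exact not_subset_iff_inter_nonempty.2 (hcross P hP Q hQ)
    · rw [inter_comm]
      exact not_subset_iff_inter_nonempty.2 (hcross Q hQ P hP)
    · let y : Fin N := ⟨N - 1, by omega⟩
      have hy : N ≤ y.val + 2 := by simp only [y]; omega
      refine ⟨i.succAbove y, mem_inter.2 ⟨mem_coPoint.2 fun h => ?_, mem_coPoint.2 fun h => ?_⟩⟩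
      · exact htop P y h hy (mem_filter.1 hP).2
      · exact htop Q y h hy (mem_filter.1 hQ).2
  · rw [diversity, hmax, hFcard, hBcard]
    omega

/-! ### The list of resistant numbers -/

section Resistant

variable {n k : ℕ}

theorem finite_isResistant (hk : 3 ≤ k) (hn : 2 * k < n) : {g : ℕ | IsResistant n k g}.Finite := by
  refine (Set.finite_Iic ((n - 4).choose (k - 3))).subset fun g hg => ?_
  obtain ⟨U, hU, rfl⟩ := (isResistant_iff hk hn).1 hg
  exact hU.lower_le hk hn

theorem resistantCount_eq (h : {g : ℕ | IsResistant n k g}.Finite) :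
    resistantCount n k = h.toFinset.card :=
  Set.ncard_eq_toFinset_card _ h

theorem resistantNumber_of_pos {l : ℕ} (hl : 1 ≤ l) :
    resistantNumber n k l = Nat.nth (IsResistant n k) (l - 1) := by
  cases l with
  | zero => omega
  | succ l => rfl

theorem isResistant_resistantNumber (hk : 3 ≤ k) (hn : 2 * k < n) {l : ℕ}
    (hl : l ∈ Icc 1 (resistantCount n k)) : IsResistant n k (resistantNumber n k l) := by
  have hf := finite_isResistant hk hn
  rw [mem_Icc, resistantCount_eq hf] at hl
  rw [resistantNumber_of_pos hl.1]
  exact Nat.nth_mem_of_lt_card hf (by omega)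

theorem resistantNumber_lt (hk : 3 ≤ k) (hn : 2 * k < n) {l l' : ℕ}
    (hl : l ∈ Icc 1 (resistantCount n k)) (hl' : l' ∈ Icc 1 (resistantCount n k)) (h : l < l') :
    resistantNumber n k l < resistantNumber n k l' := by
  have hf := finite_isResistant hk hn
  rw [mem_Icc, resistantCount_eq hf] at hl hl'
  rw [resistantNumber_of_pos hl.1, resistantNumber_of_pos hl'.1]
  exact Nat.nth_lt_nth_of_lt_card hf (by omega) (by omega)

theorem exists_resistantNumber_eq (hk : 3 ≤ k) (hn : 2 * k < n) {g : ℕ} (hg : IsResistant n k g) :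
    ∃ l ∈ Icc 1 (resistantCount n k), resistantNumber n k l = g := by
  have hf := finite_isResistant hk hn
  obtain ⟨j, hj, rfl⟩ := Nat.exists_lt_card_finite_nth_eq hf hg
  exact ⟨j + 1, by rw [mem_Icc, resistantCount_eq hf]; omega, rfl⟩

theorem resistantNumber_le_of_lt (hk : 3 ≤ k) (hn : 2 * k < n) {l g : ℕ}
    (hl : l ∈ Icc 1 (resistantCount n k)) (hg : IsResistant n k g)
    (h : resistantNumber n k (l - 1) < g) : resistantNumber n k l ≤ g := by
  obtain ⟨j, hj, rfl⟩ := exists_resistantNumber_eq hk hn hg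
  rw [mem_Icc] at hl
  have hj' := mem_Icc.1 hj
  rcases lt_trichotomy l j with hlj | rfl | hlj
  · exact (resistantNumber_lt hk hn (mem_Icc.2 hl) hj hlj).le
  · exact le_rfl
  · exfalso
    rcases eq_or_ne j (l - 1) with rfl | hne
    · exact lt_irrefl _ h
    · exact lt_asymm h (resistantNumber_lt hk hn hj (mem_Icc.2 (by omega)) (by omega))

theorem isResistant_last (n k : ℕ) : IsResistant n k ((n - 4).choose (k - 3)) := .inr rfl

theorem isResistant_one (hk : 3 ≤ k) (hn : 2 * k < n) : IsResistant n k 1 := by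
  rw [isResistant_iff hk hn]
  rcases hk.eq_or_lt with rfl | hk4
  · exact ⟨{n - 4}, isResistantCut_singleton le_rfl hn, by
      rw [lower_singleton_sub_four le_rfl hn, Nat.sub_self, Nat.choose_zero_right]⟩
  · refine ⟨{n - k - 1}, ⟨by simp, by simp; omega, ⟨by simp; omega, fun t ht => ?_⟩,
      .inl fun t ht => ?_⟩, ?_⟩
    · rw [mem_singleton.1 ht]
      omega
    · rw [mem_singleton.1 ht, above_eq_zero (m := n - k - 1 + 1) (by simp) le_rfl]
      omega
    · rw [lower_of_subset_of_le (m := n - k - 1 + 1) _ (by simp) (by omega), lower_singleton,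
        Nat.choose_self]

end Resistant

end ColexCount

open ColexCount in
theorem mainTheorem2 (n k : ℕ) (hk : 6 ≤ 2 * k) (hn : 2 * k < n) :
    -- the resistant numbers are `1 = γ_1 < ⋯ < γ_m = C(n-4, k-3)`
    ({γ : ℕ | IsResistant n k γ}.Finite ∧
      1 ≤ resistantCount n k ∧
      resistantNumber n k 1 = 1 ∧
      resistantNumber n k (resistantCount n k) = (n - 4).choose (k - 3)) ∧
    -- each of them has a unique cascade form
    (∀ l ∈ Finset.Icc 1 (resistantCount n k),
      ∃! T : Finset ℕ, IsCascadeForm n k (resistantNumber n k l) T) ∧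
    ∀ T : ℕ → Finset ℕ,
      (∀ l ∈ Finset.Icc 1 (resistantCount n k),
        IsCascadeForm n k (resistantNumber n k l) (T l)) →
      -- the upper bound
      (∀ l ∈ Finset.Icc 1 (resistantCount n k), ∀ F : Finset (Finset (Fin n)),
        IsIntersectingFamily n k F →
        resistantNumber n k (l - 1) < diversity F →
        diversity F ≤ resistantNumber n k l →
        F.card ≤ diversityBound n k (resistantNumber n k l) (T l)) ∧
      -- the bound is strictly decreasing in `l`
      (∀ l ∈ Finset.Icc 1 (resistantCount n k), ∀ l' ∈ Finset.Icc 1 (resistantCount n k),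
        l < l' →
        diversityBound n k (resistantNumber n k l') (T l') <
          diversityBound n k (resistantNumber n k l) (T l)) ∧
      -- the bound is attained for every `l`
      (∀ l ∈ Finset.Icc 1 (resistantCount n k), ∃ F : Finset (Finset (Fin n)),
        IsIntersectingFamily n k F ∧
        diversity F = resistantNumber n k l ∧
        F.card = diversityBound n k (resistantNumber n k l) (T l)) := by
  replace hk : 3 ≤ k := by omega
  have hcut : ∀ l ∈ Finset.Icc 1 (resistantCount n k),
      ∃ U, IsResistantCut n k U ∧ lower n (n - k - 1) U = resistantNumber n k l := fun l hl =>
    (isResistant_iff hk hn).1 (isResistant_resistantNumber hk hn hl)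
  obtain ⟨m, hm, hmlast⟩ := exists_resistantNumber_eq hk hn (isResistant_last n k)
  obtain ⟨o, ho, hone⟩ := exists_resistantNumber_eq hk hn (isResistant_one hk hn)
  have hm' := Finset.mem_Icc.1 hm
  have ho' := Finset.mem_Icc.1 ho
  have h1mem : 1 ∈ Finset.Icc 1 (resistantCount n k) := Finset.mem_Icc.2 (by omega)
  have hlastmem : resistantCount n k ∈ Finset.Icc 1 (resistantCount n k) :=
    Finset.mem_Icc.2 (by omega)
  refine ⟨⟨finite_isResistant hk hn, by omega, ?_, ?_⟩, fun l hl => ?_, fun T hT => ?_⟩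
  · obtain ⟨U, hU, hUl⟩ := hcut 1 h1mem
    have h1 := hU.lower_pos
    rcases ho'.1.eq_or_lt with rfl | h
    · exact hone
    · have := resistantNumber_lt hk hn h1mem ho h
      omega
  · obtain ⟨U, hU, hUl⟩ := hcut _ hlastmem
    have h1 := hU.lower_le hk hn
    rcases hm'.2.eq_or_lt with rfl | h
    · exact hmlast
    · have := resistantNumber_lt hk hn hm hlastmem h
      omega
  · obtain ⟨U, hU, hUl⟩ := hcut l hl
    rw [← hUl]
    exact ⟨reflect n U, hU.isCascadeForm (by omega),
      fun T hT => eq_reflect_of_isCascadeForm (by omega) hU.subset hU.valid hT⟩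
  -- the bound, expressed through the cut
  have hbound : ∀ l ∈ Finset.Icc 1 (resistantCount n k), ∀ U, IsResistantCut n k U →
      lower n (n - k - 1) U = resistantNumber n k l →
      diversityBound n k (resistantNumber n k l) (T l) =
        upper (n - 1) (k - 1) U + lower n (n - k - 1) U := by
    intro l hl U hU hUl
    have h := hT l hl
    rw [← hUl] at h ⊢
    rw [eq_reflect_of_isCascadeForm (by omega) hU.subset hU.valid h, hU.diversityBound_eq hk hn]
  refine ⟨fun l hl F hF hlow hupp => ?_, fun l hl l' hl' hll => ?_, fun l hl => ?_⟩
  · obtain ⟨U, hU, hUl⟩ := hcut l hl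
    have hle := hU.lower_le hk hn
    obtain ⟨V, hV, hVv, hVl, W, hW, hWg, hWle⟩ :=
      exists_isResistantCut hk hn (Nat.zero_lt_of_lt hlow) (by omega : diversity F ≤ _)
    rw [hbound l hl U hU hUl]
    refine (card_le_of_isIntersectingFamily (by omega) hn hF hV hVv hVl).trans (hWle.trans ?_)
    have h := resistantNumber_le_of_lt hk hn hl ((isResistant_iff hk hn).2 ⟨W, hW, rfl⟩)
      (hlow.trans_le hWg)
    rw [← hUl] at h
    rcases h.eq_or_lt with h | h
    · have : U = W := eq_of_lower_eq hU.subset hW.subset hU.valid hW.valid h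
      rw [this]
    · exact (hU.upper_add_lower_lt hk hn hW h).le
  · obtain ⟨U, hU, hUl⟩ := hcut l hl
    obtain ⟨U', hU', hUl'⟩ := hcut l' hl'
    rw [hbound l hl U hU hUl, hbound l' hl' U' hU' hUl']
    refine hU.upper_add_lower_lt hk hn hU' ?_
    rw [hUl, hUl']
    exact resistantNumber_lt hk hn hl hl' hll
  · obtain ⟨U, hU, hUl⟩ := hcut l hl
    obtain ⟨F, hF, h1, h2⟩ := hU.exists_isIntersectingFamily hk hn
    exact ⟨F, hF, h1.trans hUl, by rw [h2, hbound l hl U hU hUl]⟩
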